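/- Let $\mathcal B$ and $\mathcal U$ be finite sets (of base stations and of mobile users). For every $b\in\mathcal B$ let $C_b\in\mathbb N$ be the number of subchannels of $b$; let $\mathcal U'\subseteq\mathcal U$ be the set of users that ask for reassociation in the current time slot, let $\bar x_{b,u}\in\{0,1\}$ $(b\in\mathcal B,\ u\in\mathcal U)$ be the association of the previous time slot, and let $w_{b,u}\in\mathbb R$ be given constants (the connection qualities, which do not depend on the decision variables). The user-association problem (P2) is $$\begin{aligned} \text{maximize}\quad & \sum_{u\in\mathcal U}\sum_{b\in\mathcal B} x_{b,u}\,w_{b,u}\\ \text{subject to}\quad & \sum_{u\in\mathcal U}x_{b,u}\le C_b && (b\in\mathcal B),\\ & \sum_{b\in\mathcal B}x_{b,u}\le 1 && (u\in\mathcal U),\\ & x_{b,u}=\bar x_{b,u} && (u\in\mathcal U\setminus\mathcal U',\ b\in\mathcal B),\\ & x_{b,u}\in\{0,1\} && (u\in\mathcal U,\ b\in\mathcal B). \end{aligned}$$ **Proposition.** (P2) can be solved exactly in polynomial time. That is, there are a single program and a polynomial $p$ such that for every instance $(\mathcal B,\mathcal U,C,\mathcal U',\bar x,w)$ the program halts after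 at most $p(|\mathcal B|+|\mathcal U|)$ elementary steps, returns an optimal solution of (P2) if (P2) has a feasible solution, and reports that (P2) is infeasible otherwise. Here a program is a finite while-program on a random access machine whose memory consists of indirectly addressable arrays of natural numbers and arrays of real numbers. The elementary steps, each of unit cost, are reading and writing a cell, natural-number constants and the real constant $0$, addition, (for natural numbers truncated) subtraction and comparison within each of the two kinds of numbers, Boolean negation and conjunction of tests, and control flow; there is no multiplication, no rounding and no conversion between the two kinds. The input $|\mathcal B|,|\mathcal U|,C,\mathcal U',\bar x$ is given in natural-number arrays and $w$ in a real array, with the elements of $\mathcal B$ and $\mathcal U$ numbered consecutively from $0$ and all other cells $0$. -/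

import Mathlib

/-! ## The user-association problem -/

/-- An instance of the user-association problem at one time slot. `BS` is the set of base stations
and `UE` the set of mobile users. The weights are arbitrary real constants. -/
structure UAInstance (BS UE : Type) where
  /-- `numSub b` is the number of subchannels of base station `b`. -/
  numSub : BS → ℕ
  /-- `asks u` says whether user `u` asks for reassociation in the current slot. -/
  asks : UE → Bool
  /-- `prev b u` says whether `u` was associated with `b` in the previous slot. -/
  prev : BS → UE → Bool
  /-- `w b u` is the connection quality between `b` and `u`. -/
  w : BS → UE → ℝ

namespace UAInstance

/-- The constraints on the decision variables `x b u`. -/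
structure IsFeasible {BS UE : Type} [Fintype BS] [Fintype UE] (I : UAInstance BS UE)
    (x : BS → UE → ℕ) : Prop where
  capacity : ∀ b, ∑ u, x b u ≤ I.numSub b
  atMostOne : ∀ u, ∑ b, x b u ≤ 1
  continuity : ∀ u, I.asks u = false → ∀ b, x b u = (I.prev b u).toNat
  binary : ∀ u b, x b u = 0 ∨ x b u = 1

/-- The total connection quality. -/
noncomputable def objective {BS UE : Type} [Fintype BS] [Fintype UE] (I : UAInstance BS UE)
    (x : BS → UE → ℕ) : ℝ :=
  ∑ u, ∑ b, (x b u : ℝ) * I.w b u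

/-- `x` is an exact optimal solution. -/
def IsOptimal {BS UE : Type} [Fintype BS] [Fintype UE] (I : UAInstance BS UE)
    (x : BS → UE → ℕ) : Prop :=
  I.IsFeasible x ∧ ∀ y, I.IsFeasible y → I.objective y ≤ I.objective x

end UAInstance

/-! ## The machine model: an additive real RAM

A store consists of two-dimensional arrays of natural numbers and of real numbers, with
indirect access. Arithmetic on both kinds of numbers is restricted to addition, subtraction and
comparison, at unit cost. There is no multiplication, no rounding, no conversion between the two
kinds, and the only real constant is `0`, so neither a long number nor a fixed real parameter can
be used to hide work. Programs are finite and do not depend on the instance. -/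

namespace RealRAM

/-- Memory contents: array name, row, column. -/
structure Store where
  nat : ℕ → ℕ → ℕ → ℕ
  real : ℕ → ℕ → ℕ → ℝ

/-- Write `v` into cell `(i, j)` of the natural-number array `k`. -/
def Store.setNat (s : Store) (k i j v : ℕ) : Store :=
  { s with nat := fun k' i' j' => if k' = k ∧ i' = i ∧ j' = j then v else s.nat k' i' j' }

/-- Write `v` into cell `(i, j)` of the real array `k`. -/
noncomputable def Store.setReal (s : Store) (k i j : ℕ) (v : ℝ) : Store :=
  { s with real := fun k' i' j' => if k' = k ∧ i' = i ∧ j' = j then v else s.real k' i' j' }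

/-- Expressions of type natural number (subtraction is truncated). -/
inductive NExpr where
  | const (c : ℕ)
  | get (k : ℕ) (i j : NExpr)
  | add (a b : NExpr)
  | sub (a b : NExpr)

/-- Expressions of type real number. -/
inductive RExpr where
  | zero
  | get (k : ℕ) (i j : NExpr)
  | add (a b : RExpr)
  | sub (a b : RExpr)

/-- Tests. -/
inductive Test where
  | natLt (a b : NExpr)
  | realLt (a b : RExpr)
  | neg (t : Test)
  | conj (t t' : Test)

def NExpr.eval (s : Store) : NExpr → ℕ
  | const c => c
  | get k i j => s.nat k (i.eval s) (j.eval s)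
  | add a b => a.eval s + b.eval s
  | sub a b => a.eval s - b.eval s

noncomputable def RExpr.eval (s : Store) : RExpr → ℝ
  | zero => 0
  | get k i j => s.real k (i.eval s) (j.eval s)
  | add a b => a.eval s + b.eval s
  | sub a b => a.eval s - b.eval s

def Test.Holds (s : Store) : Test → Prop
  | natLt a b => a.eval s < b.eval s
  | realLt a b => a.eval s < b.eval s
  | neg t => ¬ t.Holds s
  | conj t t' => t.Holds s ∧ t'.Holds s

/-- Number of elementary operations in the evaluation of an expression. -/
def NExpr.cost : NExpr → ℕ
  | const _ => 1
  | get _ i j => i.cost + j.cost + 1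
  | add a b => a.cost + b.cost + 1
  | sub a b => a.cost + b.cost + 1

def RExpr.cost : RExpr → ℕ
  | zero => 1
  | get _ i j => i.cost + j.cost + 1
  | add a b => a.cost + b.cost + 1
  | sub a b => a.cost + b.cost + 1

def Test.cost : Test → ℕ
  | natLt a b => a.cost + b.cost + 1
  | realLt a b => a.cost + b.cost + 1
  | neg t => t.cost + 1
  | conj t t' => t.cost + t'.cost + 1

/-- Programs. `putNat k i j e` stores the value of `e` in cell `(i, j)` of array `k`, and
`loop t P` is "while `t` do `P`". -/
inductive Prog where
  | nop
  | putNat (k : ℕ) (i j : NExpr) (e : NExpr)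
  | putReal (k : ℕ) (i j : NExpr) (e : RExpr)
  | seq (P Q : Prog)
  | cond (t : Test) (P Q : Prog)
  | loop (t : Test) (P : Prog)

/-- `Exec P s T s'`: started in store `s`, the program `P` halts after exactly `T` elementary steps
in store `s'`. -/
inductive Exec : Prog → Store → ℕ → Store → Prop
  | nop (s : Store) : Exec .nop s 1 s
  | putNat (k : ℕ) (i j e : NExpr) (s : Store) :
      Exec (.putNat k i j e) s (i.cost + j.cost + e.cost + 1)
        (s.setNat k (i.eval s) (j.eval s) (e.eval s))
  | putReal (k : ℕ) (i j : NExpr) (e : RExpr) (s : Store) :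
      Exec (.putReal k i j e) s (i.cost + j.cost + e.cost + 1)
        (s.setReal k (i.eval s) (j.eval s) (e.eval s))
  | seq {P Q : Prog} {s s' s'' : Store} {T T' : ℕ} :
      Exec P s T s' → Exec Q s' T' s'' → Exec (.seq P Q) s (T + T' + 1) s''
  | condTrue {t : Test} {P Q : Prog} {s s' : Store} {T : ℕ} :
      t.Holds s → Exec P s T s' → Exec (.cond t P Q) s (t.cost + T + 1) s'
  | condFalse {t : Test} {P Q : Prog} {s s' : Store} {T : ℕ} :
      ¬ t.Holds s → Exec Q s T s' → Exec (.cond t P Q) s (t.cost + T + 1) s'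
  | loopFalse {t : Test} {P : Prog} {s : Store} :
      ¬ t.Holds s → Exec (.loop t P) s (t.cost + 1) s
  | loopTrue {t : Test} {P : Prog} {s s' s'' : Store} {T T' : ℕ} :
      t.Holds s → Exec P s T s' → Exec (.loop t P) s' T' s'' →
      Exec (.loop t P) s (t.cost + T + T' + 1) s''

end RealRAM

/-! ## Input and output conventions -/

namespace UAInstance

/-- The natural-number part of the input: array `0` holds the numbers of base stations and of
users, array `1` the numbers of subchannels, array `2` the users that ask for reassociation and
array `3` the previous association. All other cells are `0`. -/
def inputNat {m n : ℕ} (I : UAInstance (Fin m) (Fin n)) : ℕ → ℕ → ℕ → ℕ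
  | 0, 0, 0 => m
  | 0, 0, 1 => n
  | 1, b, 0 => if h : b < m then I.numSub ⟨b, h⟩ else 0
  | 2, u, 0 => if h : u < n then (I.asks ⟨u, h⟩).toNat else 0
  | 3, b, u => if h : b < m ∧ u < n then (I.prev ⟨b, h.1⟩ ⟨u, h.2⟩).toNat else 0
  | _, _, _ => 0

/-- The real part of the input: array `0` holds the weights. All other cells are `0`. -/
noncomputable def inputReal {m n : ℕ} (I : UAInstance (Fin m) (Fin n)) : ℕ → ℕ → ℕ → ℝ
  | 0, b, u => if h : b < m ∧ u < n then I.w ⟨b, h.1⟩ ⟨u, h.2⟩ else 0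
  | _, _, _ => 0

/-- The initial store on input `I`. -/
noncomputable def input {m n : ℕ} (I : UAInstance (Fin m) (Fin n)) : RealRAM.Store where
  nat := I.inputNat
  real := I.inputReal

end UAInstance

namespace RealRAM

/-- The yes/no answer found in a final store. -/
def Store.flag (s : Store) : ℕ := s.nat 4 0 0

/-- The association found in a final store. -/
def Store.association (s : Store) (m n : ℕ) : Fin m → Fin n → ℕ := fun b u => s.nat 5 b u

/-- On input `I`, the final store `s` holds a correct answer: an exact optimal solution (flag `1`)
if there is a feasible one, and the report that there is none (flag `0`) otherwise. -/
def Store.Solves {m n : ℕ} (s : Store) (I : UAInstance (Fin m) (Fin n)) : Prop :=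
  ((∃ x, I.IsFeasible x) → s.flag = 1 ∧ I.IsOptimal (s.association m n)) ∧
  ((¬ ∃ x, I.IsFeasible x) → s.flag = 0)

end RealRAM

/-!
The users that do not ask for reassociation are fixed. A feasible solution exists if and only if the
old associations of these users respect the constraints, which is checked by adding up. Their
subchannels are taken away from the capacities, and a transportation problem remains: place every
asking user at a station with a free place or at none, with maximal total weight. "None" becomes an
additional station `m` of weight `0` and with room for everybody, so that each user is placed at
exactly one station.

The program places the asking users one by one, by the Hungarian method. Next to the placement it
keeps a nonnegative price `p c` of each station, which vanishes when the station has a free place,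
and a value `y v` of each user, such that `w c v ≤ y v + p c` always, with equality if `v` is placed
at `c` (`RealRAM.Dual`). By complementary slackness, such numbers certify that the final placement
is optimal (`UAInstance.IsFeasible.isOptimal_of_dual`), and nothing else has to be known about the
intermediate ones. To place a user, a tree of alternating paths that starts from this user is grown
(`RealRAM.Tree`). In each step the prices in the tree are raised, and the values of the users placed
there are lowered, by the smallest slack `y v + p c - w c v` of an edge that leaves the tree. This
keeps all inequalities, since the stations in the tree are full (`RealRAM.Dual.raise`), and it makes
that edge tight, so that the station at its end joins the tree (`RealRAM.Tree.insert`). Because the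
station `m` is never full, a station with a free place is reached after at most `m + 1` steps. Then
every user on the path to it moves on by one station (`RealRAM.Path.step`, `RealRAM.Dual.move`).

The prices are sums and differences of weights, so additions, subtractions and comparisons suffice.
Each loop is iterated at most `m + n + 3` times, and the nesting of the loops does not depend on the
instance; therefore the running time is bounded by a polynomial that is read off from the text of
the program (`RealRAM.Prog.costPoly`). The correctness of the program is proved in a Hoare logic for
total correctness whose judgement `RealRAM.Run` includes this time bound.
-/

/-! ### A program logic with time bounds -/

open Polynomial in
/-- A polynomial bound on the running time, for runs in which every loop is iterated at most as
often as the value of the variable says. -/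
noncomputable def RealRAM.Prog.costPoly : RealRAM.Prog → Polynomial ℕ
  | nop => 1
  | putNat _ i j e => C (i.cost + j.cost + e.cost + 1)
  | putReal _ i j e => C (i.cost + j.cost + e.cost + 1)
  | seq P Q => P.costPoly + Q.costPoly + 1
  | cond t P Q => C t.cost + P.costPoly + Q.costPoly + 1
  | loop t P => (X + 1) * (C t.cost + P.costPoly + 1)

namespace RealRAM

namespace Store

variable (s : Store) (k k' i j i' j' v : ℕ) (x : ℝ)

@[simp] lemma setNat_nat_same :
    (s.setNat k i j v).nat k i' j' = if i' = i ∧ j' = j then v else s.nat k i' j' := by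
  simp [setNat]

@[simp] lemma setReal_real_same :
    (s.setReal k i j x).real k i' j' = if i' = i ∧ j' = j then x else s.real k i' j' := by
  simp [setReal]

variable {k k'} in
@[simp] lemma setNat_nat_of_ne (h : k' ≠ k) : (s.setNat k i j v).nat k' = s.nat k' := by
  funext a b; simp [setNat, h]

variable {k k'} in
@[simp] lemma setReal_real_of_ne (h : k' ≠ k) : (s.setReal k i j x).real k' = s.real k' := by
  funext a b; simp [setReal, h]

@[simp] lemma setNat_real : (s.setNat k i j v).real = s.real := rfl

@[simp] lemma setReal_nat : (s.setReal k i j x).nat = s.nat := rfl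

end Store

/-- `Run D P s Q`: started in `s`, the program `P` halts in a store that satisfies `Q`, within the
time that `Prog.costPoly` allows when no loop is iterated more than `D` times. -/
def Run (D : ℕ) (P : Prog) (s : Store) (Q : Store → Prop) : Prop :=
  ∃ T s', Exec P s T s' ∧ T ≤ P.costPoly.eval D ∧ Q s'

namespace Run

variable {D : ℕ} {P P' : Prog} {s : Store} {Q R : Store → Prop}

lemma mono (h : Run D P s Q) (hQR : ∀ s', Q s' → R s') : Run D P s R := by
  obtain ⟨T, s', h1, h2, h3⟩ := h
  exact ⟨T, s', h1, h2, hQR _ h3⟩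

lemma nop (h : Q s) : Run D .nop s Q :=
  ⟨1, s, .nop s, by simp [Prog.costPoly], h⟩

lemma putNat {k : ℕ} {i j e : NExpr} (h : Q (s.setNat k (i.eval s) (j.eval s) (e.eval s))) :
    Run D (.putNat k i j e) s Q :=
  ⟨_, _, .putNat k i j e s, by simp [Prog.costPoly], h⟩

lemma putReal {k : ℕ} {i j : NExpr} {e : RExpr}
    (h : Q (s.setReal k (i.eval s) (j.eval s) (e.eval s))) : Run D (.putReal k i j e) s Q :=
  ⟨_, _, .putReal k i j e s, by simp [Prog.costPoly], h⟩

lemma seq (h : Run D P s fun s' => Run D P' s' Q) : Run D (.seq P P') s Q := by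
  obtain ⟨T, s', h1, h2, T', s'', h3, h4, h5⟩ := h
  refine ⟨_, _, .seq h1 h3, ?_, h5⟩
  simp only [Prog.costPoly, Polynomial.eval_add, Polynomial.eval_one]
  omega

lemma cond {t : Test} (hT : t.Holds s → Run D P s Q) (hF : ¬ t.Holds s → Run D P' s Q) :
    Run D (.cond t P P') s Q := by
  by_cases ht : t.Holds s
  · obtain ⟨T, s', h1, h2, h3⟩ := hT ht
    refine ⟨_, _, .condTrue ht h1, ?_, h3⟩
    simp only [Prog.costPoly, Polynomial.eval_add, Polynomial.eval_one, Polynomial.eval_C]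
    omega
  · obtain ⟨T, s', h1, h2, h3⟩ := hF ht
    refine ⟨_, _, .condFalse ht h1, ?_, h3⟩
    simp only [Prog.costPoly, Polynomial.eval_add, Polynomial.eval_one, Polynomial.eval_C]
    omega

/-- The rule for loops. The index of the invariant bounds the number of iterations to come. -/
lemma loop {t : Test} (Inv : ℕ → Store → Prop) {N : ℕ} (hN : N ≤ D) (h0 : Inv N s)
    (hstep : ∀ i s, Inv i s → t.Holds s → ∃ j, i = j + 1 ∧ Run D P s (Inv j))
    (hQ : ∀ i s, Inv i s → ¬ t.Holds s → Q s) : Run D (.loop t P) s Q := by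
  have key : ∀ i s, Inv i s → ∃ T s', Exec (.loop t P) s T s' ∧
      T ≤ (i + 1) * (t.cost + P.costPoly.eval D + 1) ∧ Q s' := by
    intro i
    induction i with
    | zero =>
      intro s hs
      by_cases ht : t.Holds s
      · obtain ⟨j, hj, _⟩ := hstep 0 s hs ht
        omega
      · exact ⟨_, _, .loopFalse ht, by omega, hQ _ _ hs ht⟩
    | succ i ih =>
      intro s hs
      by_cases ht : t.Holds s
      · obtain ⟨j, hj, T, s', h1, h2, h3⟩ := hstep _ s hs ht
        obtain rfl : i = j := by omega
        obtain ⟨T', s'', h4, h5, h6⟩ := ih s' h3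
        refine ⟨_, _, .loopTrue ht h1 h4, ?_, h6⟩
        rw [Nat.succ_mul]
        omega
      · refine ⟨_, _, .loopFalse ht, ?_, hQ _ _ hs ht⟩
        rw [Nat.succ_mul]
        omega
  obtain ⟨T, s', h1, h2, h3⟩ := key N s h0
  refine ⟨T, s', h1, h2.trans ?_, h3⟩
  simp only [Prog.costPoly, Polynomial.eval_add, Polynomial.eval_one, Polynomial.eval_C,
    Polynomial.eval_mul, Polynomial.eval_X]
  gcongr

end Run

/-- The scalar variable kept in cell `(0, 0)` of the array `k`. -/
abbrev scalar (k : ℕ) : NExpr := .get k (.const 0) (.const 0)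

/-- Entry `i` of the one-dimensional array kept in column `0` of the array `k`. -/
abbrev entry (k : ℕ) (i : NExpr) : NExpr := .get k i (.const 0)

/-- Entry `i` of the one-dimensional real array kept in column `0` of the array `k`. -/
abbrev realEntry (k : ℕ) (i : NExpr) : RExpr := .get k i (.const 0)

/-- Assignment to a scalar variable. -/
abbrev assign (k : ℕ) (e : NExpr) : Prog := .putNat k (.const 0) (.const 0) e

/-- Assignment to an entry of a one-dimensional array. -/
abbrev assignEntry (k : ℕ) (i e : NExpr) : Prog := .putNat k i (.const 0) e

/-- Assignment to an entry of a one-dimensional real array. -/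
abbrev assignReal (k : ℕ) (i : NExpr) (e : RExpr) : Prog := .putReal k i (.const 0) e

/-- `for k = 0, …, N - 1 do P`, with the counter in the scalar variable `k`. -/
def forLoop (k : ℕ) (N : NExpr) (P : Prog) : Prog :=
  .seq (assign k (.const 0))
    (.loop (.natLt (scalar k) N) (.seq P (assign k (.add (scalar k) (.const 1)))))

lemma Run.forLoop {D k : ℕ} {N : NExpr} {P : Prog} {s : Store} {Q : Store → Prop}
    (Inv : ℕ → Store → Prop) {Nv : ℕ} (hD : Nv ≤ D) (hN : ∀ i s, Inv i s → N.eval s = Nv)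
    (h0 : Inv 0 (s.setNat k 0 0 0))
    (hstep : ∀ i s, i < Nv → s.nat k 0 0 = i → Inv i s →
      Run D P s fun s' => s'.nat k 0 0 = i ∧ Inv (i + 1) (s'.setNat k 0 0 (i + 1)))
    (hQ : ∀ s, Inv Nv s → Q s) : Run D (forLoop k N P) s Q := by
  refine .seq (.putNat ?_)
  refine .loop (fun j s => ∃ i, j + i = Nv ∧ s.nat k 0 0 = i ∧ Inv i s) hD
    ⟨0, by simp, by simp [NExpr.eval], h0⟩ ?_ ?_
  · rintro j s ⟨i, hj, hi, hI⟩ ht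
    simp only [Test.Holds, NExpr.eval, hN i s hI, hi] at ht
    refine ⟨j - 1, by omega, .seq ?_⟩
    refine (hstep i s ht hi hI).mono ?_
    rintro s' ⟨h1, h2⟩
    refine .putNat ⟨i + 1, by omega, ?_⟩
    simp only [NExpr.eval, h1]
    exact ⟨by simp, h2⟩
  · rintro j s ⟨i, hj, hi, hI⟩ ht
    simp only [Test.Holds, NExpr.eval, hN i s hI, hi] at ht
    obtain rfl : i = Nv := by omega
    exact hQ s hI

/-- The stores `s` and `s'` agree outside the natural-number arrays in `K` and the real arrays
in `R`. -/
structure Same (K R : List ℕ) (s s' : Store) : Prop where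
  nat : ∀ k, k ∉ K → s'.nat k = s.nat k
  real : ∀ k, k ∉ R → s'.real k = s.real k

namespace Same

variable {K R K' R' : List ℕ} {s s' s'' : Store}

lemma refl (K R : List ℕ) (s : Store) : Same K R s s := ⟨fun _ _ => rfl, fun _ _ => rfl⟩

lemma trans (h : Same K R s s') (h' : Same K' R' s' s'') (hK : K' ⊆ K := by decide)
    (hR : R' ⊆ R := by decide) : Same K R s s'' :=
  ⟨fun k hk => (h'.nat k fun hm => hk (hK hm)).trans (h.nat k hk),
   fun k hk => (h'.real k fun hm => hk (hR hm)).trans (h.real k hk)⟩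

lemma setNat (h : Same K R s s') (k i j v : ℕ) (hk : k ∈ K := by decide) :
    Same K R s (s'.setNat k i j v) := by
  refine ⟨fun k' hk' => ?_, h.real⟩
  rw [Store.setNat_nat_of_ne _ _ _ _ (by rintro rfl; exact hk' hk), h.nat k' hk']

lemma setReal (h : Same K R s s') (k i j : ℕ) (x : ℝ) (hk : k ∈ R := by decide) :
    Same K R s (s'.setReal k i j x) := by
  refine ⟨h.nat, fun k' hk' => ?_⟩
  rw [Store.setReal_real_of_ne _ _ _ _ (by rintro rfl; exact hk' hk), h.real k' hk']

end Same

end RealRAM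

/-! ### Optimality from dual prices -/

open Finset in
/-- Complementary slackness: prices `p` of the base stations and values `y` of the users certify
that an association is optimal. -/
lemma UAInstance.IsFeasible.isOptimal_of_dual {BS UE : Type} [Fintype BS] [Fintype UE]
    {I : UAInstance BS UE} {x : BS → UE → ℕ} (hx : I.IsFeasible x) (p : BS → ℝ) (y : UE → ℝ)
    (hle : ∀ u, I.asks u = true → ∀ b, I.w b u ≤ y u + p b)
    (htight : ∀ u, I.asks u = true → ∀ b, x b u = 1 → I.w b u = y u + p b)
    (hp : ∀ b, 0 ≤ p b) (hy : ∀ u, I.asks u = true → 0 ≤ y u)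
    (hyc : ∀ u, I.asks u = true → y u = 0 ∨ ∑ b, x b u = 1)
    (hpc : ∀ b, p b = 0 ∨ ∑ u, x b u = I.numSub b) : I.IsOptimal x := by
  refine ⟨hx, fun z hz => ?_⟩
  have huser : ∀ u, ∑ b, (z b u : ℝ) * I.w b u - ∑ b, (x b u : ℝ) * I.w b u ≤
      ∑ b, ((z b u : ℝ) - x b u) * p b := by
    intro u
    cases hu : I.asks u with
    | false =>
      have hzx : ∀ b, z b u = x b u := fun b => by
        rw [hz.continuity u hu b, hx.continuity u hu b]
      simp [hzx]
    | true =>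
      have h1 : ∑ b, (z b u : ℝ) * I.w b u ≤ ∑ b, (z b u : ℝ) * (y u + p b) :=
        sum_le_sum fun b _ => mul_le_mul_of_nonneg_left (hle u hu b) (Nat.cast_nonneg _)
      have h2 : ∑ b, (x b u : ℝ) * I.w b u = ∑ b, (x b u : ℝ) * (y u + p b) := by
        refine sum_congr rfl fun b _ => ?_
        rcases hx.binary u b with h | h
        · simp [h]
        · rw [htight u hu b h]
      have h3 : (∑ b, (z b u : ℝ)) * y u ≤ (∑ b, (x b u : ℝ)) * y u := by
        rcases hyc u hu with h | h
        · simp [h]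
        · refine mul_le_mul_of_nonneg_right ?_ (hy u hu)
          rw [← Nat.cast_sum, ← Nat.cast_sum, h]
          exact_mod_cast hz.atMostOne u
      simp only [mul_add, sum_add_distrib, ← sum_mul] at h1 h2
      simp only [sub_mul, sum_sub_distrib]
      linarith
  have hstation : ∀ b, ∑ u, ((z b u : ℝ) - x b u) * p b ≤ 0 := by
    intro b
    rw [← sum_mul, sum_sub_distrib]
    rcases hpc b with h | h
    · simp [h]
    · refine mul_nonpos_of_nonpos_of_nonneg ?_ (hp b)
      rw [sub_nonpos, ← Nat.cast_sum, ← Nat.cast_sum, h]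
      exact_mod_cast hz.capacity b
  have h := sum_le_sum fun u (_ : u ∈ univ) => huser u
  rw [sum_sub_distrib, sum_comm (f := fun u b => ((z b u : ℝ) - x b u) * p b)] at h
  have h' := sum_nonpos fun b (_ : b ∈ univ) => hstation b
  unfold objective
  linarith

namespace RealRAM

/-! ### Dual prices and alternating trees -/

/-- The number of users `v < n` that the placement `a` puts at station `c`. -/
def load (n : ℕ) (a : ℕ → ℕ) (c : ℕ) : ℕ :=
  ∑ v ∈ Finset.range n, if a v = c then 1 else 0

lemma load_move {n v : ℕ} (hv : v < n) {a a' : ℕ → ℕ} {c : ℕ}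
    (h : ∀ u, a' u = if u = v then c else a u) (d : ℕ) :
    load n a' d + (if a v = d then 1 else 0) = load n a d + (if c = d then 1 else 0) := by
  unfold load
  rw [← Finset.add_sum_erase _ _ (Finset.mem_range.2 hv),
    ← Finset.add_sum_erase (a := v) _ (fun v => if a v = d then 1 else 0) (Finset.mem_range.2 hv)]
  have : ∑ u ∈ (Finset.range n).erase v, (if a' u = d then 1 else 0) =
      ∑ u ∈ (Finset.range n).erase v, (if a u = d then 1 else 0) := by
    refine Finset.sum_congr rfl fun u hu => ?_
    rw [h, if_neg (Finset.ne_of_mem_erase hu)]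
  rw [this, h v, if_pos rfl]
  omega

lemma load_le (n : ℕ) (a : ℕ → ℕ) (c : ℕ) : load n a c ≤ n := by
  unfold load
  rw [← Finset.card_filter]
  exact (Finset.card_filter_le _ _).trans (by simp)

lemma load_eq_zero {n : ℕ} {a : ℕ → ℕ} {c : ℕ} : load n a c = 0 ↔ ∀ v < n, a v ≠ c := by
  simp [load]

/-- Dual prices for a partial placement `a` of the users `v < n`. The base stations are the numbers
below `m`; the number `m` is an additional station that offers weight `0` to everybody, and a user
placed there stays without a base station. A user with `a v = m + 1` is looking for a station, and
one with `a v = m + 2` takes no part. The number of free places at `c` is `r c`. -/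
structure Dual (m n : ℕ) (W : ℕ → ℕ → ℝ) (a r : ℕ → ℕ) (y p : ℕ → ℝ) : Prop where
  le : ∀ v < n, a v ≤ m + 1 → ∀ c ≤ m, W c v ≤ y v + p c
  tight : ∀ v < n, a v ≤ m → W (a v) v = y v + p (a v)
  nonneg : ∀ c ≤ m, 0 ≤ p c
  compl : ∀ c ≤ m, r c ≠ 0 → p c = 0

/-- An alternating tree that grows from the looking user. A station `c` belongs to the tree if
`S c ≠ 0`, and `S c` is then its rank in the order in which the stations were found. The user
`par c`, who is placed at a station of smaller rank, could move to `c` without loss. -/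
structure Tree (m n : ℕ) (W : ℕ → ℕ → ℝ) (a : ℕ → ℕ) (y p : ℕ → ℝ) (S par : ℕ → ℕ) : Prop where
  root : S (m + 1) = 1
  idle : S (m + 2) = 0
  lt : ∀ c ≤ m, S c ≠ 0 → par c < n
  rank_pos : ∀ c ≤ m, S c ≠ 0 → S (a (par c)) ≠ 0
  rank_lt : ∀ c ≤ m, S c ≠ 0 → S (a (par c)) < S c
  tight : ∀ c ≤ m, S c ≠ 0 → W c (par c) = y (par c) + p c

section

variable {m n : ℕ} {W : ℕ → ℕ → ℝ} {a a' r r' S S' par par' : ℕ → ℕ} {y y' p p' : ℕ → ℝ} {δ : ℝ}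

/-- Prices in the tree may be raised by the smallest slack of an edge that leaves it. -/
lemma Dual.raise (h : Dual m n W a r y p)
    (hfull : ∀ c ≤ m, S c ≠ 0 → r c = 0) (hδ : 0 ≤ δ)
    (hmin : ∀ c ≤ m, S c = 0 → ∀ v < n, S (a v) ≠ 0 → δ ≤ y v + p c - W c v)
    (hy : ∀ v < n, y' v = if S (a v) ≠ 0 then y v - δ else y v)
    (hp : ∀ c ≤ m, p' c = if S c ≠ 0 then p c + δ else p c) : Dual m n W a r y' p' where
  le v hv hav c hc := by
    have := h.le v hv hav c hc
    rw [hy v hv, hp c hc]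
    by_cases h1 : S (a v) = 0 <;> by_cases h2 : S c = 0 <;> simp only [h1, h2, ne_eq,
      not_true_eq_false, not_false_eq_true, if_true, if_false]
    · exact this
    · linarith
    · have := hmin c hc h2 v hv h1
      linarith
    · linarith
  tight v hv hav := by
    rw [h.tight v hv hav, hy v hv, hp _ hav]
    split_ifs <;> ring
  nonneg c hc := by
    have := h.nonneg c hc
    rw [hp c hc]
    split_ifs <;> linarith
  compl c hc hr := by
    rw [hp c hc, if_neg fun hSc => hr (hfull c hc hSc), h.compl c hc hr]

/-- After the prices have been raised, the edge of smallest slack may be added to the tree. -/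
lemma Tree.insert (h : Tree m n W a y p S par) {c₀ v₀ t : ℕ} (hc₀ : c₀ ≤ m) (hS₀ : S c₀ = 0)
    (hv₀ : v₀ < n) (hSv₀ : S (a v₀) ≠ 0) (hδ : δ = y v₀ + p c₀ - W c₀ v₀)
    (ht : ∀ c ≤ m + 1, S c < t) (ha : ∀ v < n, a v ≤ m + 2)
    (hy : ∀ v < n, y' v = if S (a v) ≠ 0 then y v - δ else y v)
    (hp : ∀ c ≤ m, p' c = if S c ≠ 0 then p c + δ else p c)
    (hS' : ∀ c, S' c = if c = c₀ then t else S c)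
    (hpar' : ∀ c, par' c = if c = c₀ then v₀ else par c) : Tree m n W a y' p' S' par' where
  root := by rw [hS', if_neg (by omega), h.root]
  idle := by rw [hS', if_neg (by omega), h.idle]
  lt c hc hc' := by
    rw [hpar']
    rw [hS'] at hc'
    split_ifs at hc' ⊢ with hcc
    · exact hv₀
    · exact h.lt c hc hc'
  rank_pos c hc hc' := by
    rw [hS'] at hc'
    rw [hpar' c]
    split_ifs at hc' ⊢ with hcc
    · rw [hS', if_neg (by rintro he; rw [he] at hSv₀; exact hSv₀ hS₀)]
      exact hSv₀
    · have := h.rank_pos c hc hc'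
      rw [hS', if_neg (by rintro he; rw [he] at this; exact this hS₀)]
      exact this
  rank_lt c hc hc' := by
    rw [hS'] at hc'
    rw [hpar' c, hS' c]
    split_ifs at hc' ⊢ with hcc
    · rw [hS', if_neg (by rintro he; rw [he] at hSv₀; exact hSv₀ hS₀)]
      refine ht _ ?_
      have h1 := ha v₀ hv₀
      have h2 : a v₀ ≠ m + 2 := by rintro he; rw [he] at hSv₀; exact hSv₀ h.idle
      omega
    · have := h.rank_pos c hc hc'
      rw [hS', if_neg (by rintro he; rw [he] at this; exact this hS₀)]
      exact h.rank_lt c hc hc'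
  tight c hc hc' := by
    rw [hS'] at hc'
    rw [hpar' c, hp c hc]
    split_ifs at hc' ⊢ with hcc h1
    · subst hcc; exact absurd hS₀ h1
    · rw [hy _ hv₀, if_pos hSv₀, hδ, hcc]
      ring
    · rw [hy _ (h.lt c hc hc'), if_pos (h.rank_pos c hc hc'), h.tight c hc hc']
      ring

/-- The part of an alternating tree of rank at most that of `c₀`, which is all that is needed to
follow the path from `c₀` to the root. -/
structure Path (m n : ℕ) (W : ℕ → ℕ → ℝ) (a : ℕ → ℕ) (y p : ℕ → ℝ) (S par : ℕ → ℕ)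
    (c₀ : ℕ) : Prop where
  le : c₀ ≤ m + 1
  pos : S c₀ ≠ 0
  idle : S (m + 2) = 0
  lt : ∀ c ≤ m, S c ≠ 0 → S c ≤ S c₀ → par c < n
  rank_pos : ∀ c ≤ m, S c ≠ 0 → S c ≤ S c₀ → S (a (par c)) ≠ 0
  rank_lt : ∀ c ≤ m, S c ≠ 0 → S c ≤ S c₀ → S (a (par c)) < S c
  tight : ∀ c ≤ m, S c ≠ 0 → S c ≤ S c₀ → W c (par c) = y (par c) + p c

lemma Tree.path (h : Tree m n W a y p S par) {c₀ : ℕ} (hc₀ : c₀ ≤ m) (hS : S c₀ ≠ 0) :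
    Path m n W a y p S par c₀ :=
  ⟨by omega, hS, h.idle, fun c hc h1 _ => h.lt c hc h1, fun c hc h1 _ => h.rank_pos c hc h1,
    fun c hc h1 _ => h.rank_lt c hc h1, fun c hc h1 _ => h.tight c hc h1⟩

/-- When the user `par c₀` has moved to `c₀`, the search for a path goes on at the station that
this user has left. -/
lemma Path.step {c₀ : ℕ} (h : Path m n W a y p S par c₀) (hc₀ : c₀ ≤ m)
    (ha : ∀ v < n, a v ≤ m + 2) (ha' : ∀ v, a' v = if v = par c₀ then c₀ else a v) :
    Path m n W a' y p S par (a (par c₀)) := by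
  have hlt := h.rank_lt c₀ hc₀ h.pos le_rfl
  -- Users that are met later on the path have not been moved, since ranks decrease along it.
  have hne : ∀ c ≤ m, S c ≠ 0 → S c ≤ S (a (par c₀)) → a' (par c) = a (par c) := by
    intro c hc h1 h2
    rw [ha', if_neg]
    intro he
    have := h.rank_lt c hc h1 (by omega)
    rw [he] at this
    omega
  refine ⟨?_, h.rank_pos c₀ hc₀ h.pos le_rfl, h.idle, fun c hc h1 h2 => h.lt c hc h1 (by omega),
    fun c hc h1 h2 => ?_, fun c hc h1 h2 => ?_, fun c hc h1 h2 => h.tight c hc h1 (by omega)⟩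
  · have h1 := ha _ (h.lt c₀ hc₀ h.pos le_rfl)
    have h2 : a (par c₀) ≠ m + 2 := by
      intro he
      have := h.rank_pos c₀ hc₀ h.pos le_rfl
      rw [he] at this
      exact this h.idle
    omega
  · rw [hne c hc h1 h2]
    exact h.rank_pos c hc h1 (by omega)
  · rw [hne c hc h1 h2]
    exact h.rank_lt c hc h1 (by omega)

lemma Dual.move (h : Dual m n W a r y p) {v₀ c₀ : ℕ} (hv₀ : a v₀ ≤ m + 1)
    (ht : W c₀ v₀ = y v₀ + p c₀) (ha' : ∀ v, a' v = if v = v₀ then c₀ else a v) :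
    Dual m n W a' r y p where
  le v hv hav := by
    rw [ha'] at hav
    split_ifs at hav with hvv
    · subst hvv
      exact h.le v hv hv₀
    · exact h.le v hv hav
  tight v hv hav := by
    rw [ha'] at hav ⊢
    split_ifs at hav ⊢ with hvv
    · rw [hvv, ht]
    · exact h.tight v hv hav
  nonneg := h.nonneg
  compl := h.compl

/-- An additional user joins as a looking user; its value has to exceed all its profits. -/
lemma Dual.join (h : Dual m n W a r y p) {v₀ : ℕ}
    (hy₀ : ∀ c ≤ m, W c v₀ ≤ y' v₀ + p c) (hy : ∀ v, v ≠ v₀ → y' v = y v)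
    (ha' : ∀ v, a' v = if v = v₀ then m + 1 else a v) : Dual m n W a' r y' p where
  le v hv hav c hc := by
    rw [ha'] at hav
    split_ifs at hav with hvv
    · subst hvv
      exact hy₀ c hc
    · rw [hy v hvv]
      exact h.le v hv hav c hc
  tight v hv hav := by
    rw [ha'] at hav ⊢
    split_ifs at hav ⊢ with hvv
    · omega
    · rw [hy v hvv]
      exact h.tight v hv hav
  nonneg := h.nonneg
  compl := h.compl

/-- The placement `a` and the numbers `r` of free places agree with the capacities, up to one
place at `c₀` that is neither taken nor counted as free. The capacity of `m + 1` is one. -/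
structure Balanced (m n : ℕ) (cap a r : ℕ → ℕ) (c₀ : ℕ) : Prop where
  le : ∀ v < n, a v ≤ m + 2
  eq : ∀ c ≤ m, load n a c + (if c₀ = c then 1 else 0) + r c = cap c
  looking : load n a (m + 1) + (if c₀ = m + 1 then 1 else 0) = 1

lemma Balanced.move {cap : ℕ → ℕ} {c₀ v₀ : ℕ} (h : Balanced m n cap a r c₀) (hv₀ : v₀ < n)
    (hc₀ : c₀ ≤ m) (ha' : ∀ v, a' v = if v = v₀ then c₀ else a v) :
    Balanced m n cap a' r (a v₀) where
  le v hv := by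
    rw [ha']
    split_ifs
    · omega
    · exact h.le v hv
  eq c hc := by
    have := load_move hv₀ ha' c
    have := h.eq c hc
    omega
  looking := by
    have := load_move hv₀ ha' (m + 1)
    have := h.looking
    omega

end

/-! ### The search for an alternating path -/

/-- The number of base stations. -/
abbrev numStations : NExpr := .get 0 (.const 0) (.const 0)

/-- The number of users. -/
abbrev numUsers : NExpr := .get 0 (.const 0) (.const 1)

/-- The slack `y v + p c - w c v` of a user `v` at a station `c`. -/
abbrev slackExpr (c v : NExpr) : RExpr :=
  .sub (.add (realEntry 2 v) (realEntry 1 c)) (.get 0 c v)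

/-- The value of `slackExpr` at the station `c` and the user `v`. -/
def slack (s : Store) (c v : ℕ) : ℝ := s.real 2 v 0 + s.real 1 c 0 - s.real 0 c v

/-- Find a station in variable `15` outside the tree and a user in variable `16` placed in the tree
with the smallest possible slack, which is kept in the real variable `3`. The station without
subchannels and the looking user, who is given in variable `12`, are one possible choice. -/
def minSlack : Prog :=
  .seq (assign 15 numStations) <| .seq (assign 16 (scalar 12)) <|
  .seq (assignReal 3 (.const 0) (slackExpr numStations (scalar 12))) <|
  forLoop 10 (.add numStations (.const 1)) <|
    .cond (.natLt (entry 8 (scalar 10)) (.const 1))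
      (forLoop 11 numUsers <|
        .cond (.conj (.natLt (.const 0) (entry 8 (entry 7 (scalar 11))))
            (.realLt (slackExpr (scalar 10) (scalar 11)) (realEntry 3 (.const 0))))
          (.seq (assign 15 (scalar 10)) <| .seq (assign 16 (scalar 11)) <|
            assignReal 3 (.const 0) (slackExpr (scalar 10) (scalar 11)))
          .nop)
      .nop

/-- In the store `s'`, reached from `s`, a pair of smallest slack has been found among the pairs in
`X` and some pair outside `X`. -/
structure MinSlack (m n : ℕ) (s : Store) (X : ℕ → ℕ → Prop) (s' : Store) : Prop where
  same : Same [10, 11, 15, 16] [3] s s'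
  station_le : s'.nat 15 0 0 ≤ m
  station_out : s.nat 8 (s'.nat 15 0 0) 0 = 0
  user_lt : s'.nat 16 0 0 < n
  user_in : s.nat 8 (s.nat 7 (s'.nat 16 0 0) 0) 0 ≠ 0
  eq : s'.real 3 0 0 = slack s (s'.nat 15 0 0) (s'.nat 16 0 0)
  min : ∀ c v, X c v → s.nat 8 c 0 = 0 → s.nat 8 (s.nat 7 v 0) 0 ≠ 0 →
    s'.real 3 0 0 ≤ slack s c v

lemma MinSlack.setNat {m n : ℕ} {s s' : Store} {X : ℕ → ℕ → Prop} (h : MinSlack m n s X s')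
    (k i j v : ℕ) (hk : k = 10 ∨ k = 11) : MinSlack m n s X (s'.setNat k i j v) := by
  have h1 : (15 : ℕ) ≠ k := by omega
  have h2 : (16 : ℕ) ≠ k := by omega
  obtain ⟨hs, h3, h4, h5, h6, h7, h8⟩ := h
  refine ⟨hs.setNat _ _ _ _ (by rcases hk with rfl | rfl <;> decide), ?_, ?_, ?_, ?_, ?_, ?_⟩ <;>
  simpa only [Store.setNat_nat_of_ne _ _ _ _ h1, Store.setNat_nat_of_ne _ _ _ _ h2,
    Store.setNat_real]

lemma MinSlack.weaken {m n : ℕ} {s s' : Store} {X Y : ℕ → ℕ → Prop} (h : MinSlack m n s X s')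
    (hY : ∀ c v, Y c v → s.nat 8 c 0 = 0 → s.nat 8 (s.nat 7 v 0) 0 ≠ 0 → X c v) :
    MinSlack m n s Y s' :=
  ⟨h.same, h.station_le, h.station_out, h.user_lt, h.user_in, h.eq,
    fun c v hcv h1 h2 => h.min c v (hY c v hcv h1 h2) h1 h2⟩

lemma run_minSlack {m n D : ℕ} {s : Store} (hmD : m < D) (hnD : n < D) (hm : s.nat 0 0 0 = m)
    (hn : s.nat 0 0 1 = n) (hk : s.nat 12 0 0 < n) (hSm : s.nat 8 m 0 = 0)
    (hSk : s.nat 8 (s.nat 7 (s.nat 12 0 0) 0) 0 ≠ 0) :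
    Run D minSlack s (MinSlack m n s fun c v => c ≤ m ∧ v < n) := by
  refine .seq (.putNat (.seq (.putNat (.seq (.putReal ?_)))))
  refine .forLoop (fun i => MinSlack m n s fun c v => c < i ∧ v < n) (Nv := m + 1) hmD ?_ ?_ ?_ ?_
  · intro i s' h
    simp [NExpr.eval, h.same.nat, hm]
  · refine MinSlack.setNat ?_ _ _ _ _ (Or.inl rfl)
    refine ⟨?_, ?_, ?_, ?_, ?_, ?_, ?_⟩
    · exact ((((Same.refl _ _ s).setNat _ _ _ _).setNat _ _ _ _).setReal _ _ _ _)
    all_goals simp [NExpr.eval, RExpr.eval, hm, hk, hSm, hSk, slack]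
  · intro c s₁ hc hi h₁
    refine .cond (fun ht => ?_) (fun ht => ?_)
    · simp [Test.Holds, NExpr.eval, hi, h₁.same.nat] at ht
      refine .forLoop (fun i s' => s'.nat 10 0 0 = c ∧
        MinSlack m n s (fun c' v => c' < c ∧ v < n ∨ c' = c ∧ v < i) s') hnD.le ?_ ?_ ?_ ?_
      · rintro i s' ⟨-, h⟩
        simp [NExpr.eval, h.same.nat, hn]
      · refine ⟨by simpa using hi, (h₁.weaken ?_).setNat _ _ _ _ (Or.inr rfl)⟩
        rintro c' v (h | h)
        · exact fun _ _ => h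
        · omega
      · rintro v s₂ hv hvi ⟨hci, h₂⟩
        have hsl : RExpr.eval s₂ (slackExpr (scalar 10) (scalar 11)) = slack s c v := by
          simp [RExpr.eval, NExpr.eval, slack, hci, hvi, h₂.same.real]
        refine .cond (fun ht' => ?_) (fun ht' => ?_)
        · have h3 : s.nat 8 (s.nat 7 v 0) 0 ≠ 0 ∧ slack s c v < s₂.real 3 0 0 := by
            simpa only [Test.Holds, hsl] using
              (by simpa [Test.Holds, NExpr.eval, RExpr.eval, hvi, hci, h₂.same.nat, h₂.same.real,
                slack, Nat.pos_iff_ne_zero] using ht')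
          refine .seq (.putNat (.seq (.putNat (.putReal ?_))))
          refine ⟨by simpa using hvi, by simpa using hci, MinSlack.setNat ?_ _ _ _ _ (Or.inr rfl)⟩
          have hδ : (RExpr.eval ((s₂.setNat 15 0 0 c).setNat 16 0 0 v)
              (slackExpr (scalar 10) (scalar 11))) = slack s c v := by
            simp [RExpr.eval, NExpr.eval, slack, hci, hvi, h₂.same.real]
          simp only [NExpr.eval, hci, hvi, 
            Store.setNat_nat_of_ne s₂ _ _ _ (show (11 : ℕ) ≠ 15 by decide), hδ]
          refine ⟨((h₂.same.setNat _ _ _ _).setNat _ _ _ _).setReal _ _ _ _, ?_, ?_, ?_, ?_, ?_, ?_⟩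
          · simpa using Nat.lt_succ_iff.1 hc
          · simpa using ht
          · simpa using hv
          · simpa using h3.1
          · simp
          · intro c' v' hX h5 h6
            simp only [Store.setReal_real_same, and_self, if_true]
            by_cases hcv : c' = c ∧ v' = v
            · rw [hcv.1, hcv.2]
            · exact h3.2.le.trans (h₂.min c' v' (by omega) h5 h6)
        · refine .nop ⟨hvi, by simpa using hci, MinSlack.setNat ?_ _ _ _ _ (Or.inr rfl)⟩
          refine ⟨h₂.same, h₂.station_le, h₂.station_out, h₂.user_lt, h₂.user_in, h₂.eq, ?_⟩
          intro c' v' hX h5 h6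
          by_cases hcv : c' = c ∧ v' = v
          · obtain ⟨rfl, rfl⟩ := hcv
            by_contra hlt
            refine ht' ?_
            simp only [Test.Holds, hsl]
            simpa [NExpr.eval, RExpr.eval, hvi, h₂.same.nat, Nat.pos_iff_ne_zero, h6]
              using hlt
          · exact h₂.min c' v' (by omega) h5 h6
      · rintro s₂ ⟨hci, h₂⟩
        refine ⟨hci, (h₂.weaken ?_).setNat _ _ _ _ (Or.inl rfl)⟩
        intro c' v h _ _
        omega
    · simp [Test.Holds, NExpr.eval, hi, h₁.same.nat] at ht
      refine .nop ⟨hi, (h₁.weaken ?_).setNat _ _ _ _ (Or.inl rfl)⟩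
      intro c' v h h5 _
      refine ⟨?_, h.2⟩
      rcases Nat.lt_succ_iff_lt_or_eq.1 h.1 with h' | rfl
      · exact h'
      · exact absurd h5 ht
  · intro s' h
    exact h.weaken fun c v h _ _ => ⟨by omega, h.2⟩

/-- Raise the prices in the tree by the amount in the real variable `3`. -/
def raisePrices : Prog :=
  .seq
    (forLoop 10 (.add numStations (.const 1)) <|
      .cond (.natLt (.const 0) (entry 8 (scalar 10)))
        (assignReal 1 (scalar 10) (.add (realEntry 1 (scalar 10)) (realEntry 3 (.const 0)))) .nop)
    (forLoop 11 numUsers <|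
      .cond (.natLt (.const 0) (entry 8 (entry 7 (scalar 11))))
        (assignReal 2 (scalar 11) (.sub (realEntry 2 (scalar 11)) (realEntry 3 (.const 0)))) .nop)

lemma run_raisePrices {m n D : ℕ} {s : Store} (hmD : m < D) (hnD : n < D) (hm : s.nat 0 0 0 = m)
    (hn : s.nat 0 0 1 = n) :
    Run D raisePrices s fun s' => Same [10, 11] [1, 2] s s' ∧
      (∀ c ≤ m, s'.real 1 c 0 =
        if s.nat 8 c 0 ≠ 0 then s.real 1 c 0 + s.real 3 0 0 else s.real 1 c 0) ∧
      ∀ v < n, s'.real 2 v 0 =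
        if s.nat 8 (s.nat 7 v 0) 0 ≠ 0 then s.real 2 v 0 - s.real 3 0 0 else s.real 2 v 0 := by
  refine .seq (.forLoop (fun i s' => Same [10] [1] s s' ∧ ∀ c, s'.real 1 c 0 =
        if c < i ∧ s.nat 8 c 0 ≠ 0 then s.real 1 c 0 + s.real 3 0 0 else s.real 1 c 0)
        (Nv := m + 1) hmD ?_ ?_ ?_ ?_)
  · rintro i s' ⟨h, -⟩
    simp [NExpr.eval, h.nat, hm]
  · exact ⟨(Same.refl _ _ s).setNat _ _ _ _, by simp⟩
  · rintro i s' hi hc ⟨h, hp⟩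
    refine .cond (fun ht => .putReal ?_) (fun ht => .nop ?_)
    · simp [Test.Holds, NExpr.eval, hc, h.nat] at ht
      refine ⟨by simpa using hc, (h.setReal _ _ _ _).setNat _ _ _ _, fun c => ?_⟩
      simp only [NExpr.eval, RExpr.eval, hc, Store.setNat_real, Store.setReal_real_same, and_true]
      rw [hp c, hp i, h.real 3 (by decide)]
      grind
    · simp [Test.Holds, NExpr.eval, hc, h.nat] at ht
      refine ⟨hc, h.setNat _ _ _ _, fun c => ?_⟩
      simp only [Store.setNat_real]
      rw [hp c]
      grind
  rintro s₁ ⟨h₁, hp₁⟩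
  refine .forLoop (fun i s' => Same [10, 11] [1, 2] s s' ∧ s'.real 1 = s₁.real 1 ∧
      ∀ v, s'.real 2 v 0 = if v < i ∧ s.nat 8 (s.nat 7 v 0) 0 ≠ 0
        then s.real 2 v 0 - s.real 3 0 0 else s.real 2 v 0) hnD.le ?_ ?_ ?_ ?_
  · rintro i s' ⟨h, -⟩
    simp [NExpr.eval, h.nat, hn]
  · refine ⟨((Same.refl _ _ s).trans h₁).setNat _ _ _ _, by simp, ?_⟩
    simp [h₁.real]
  · rintro i s' hi hc ⟨h, hp, hy⟩
    refine .cond (fun ht => .putReal ?_) (fun ht => .nop ?_)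
    · simp [Test.Holds, NExpr.eval, hc, h.nat] at ht
      refine ⟨by simpa using hc, (h.setReal _ _ _ _).setNat _ _ _ _, by simpa using hp,
        fun v => ?_⟩
      simp only [NExpr.eval, RExpr.eval, hc, Store.setNat_real, Store.setReal_real_same, and_true]
      rw [hy v, hy i, h.real 3 (by decide)]
      grind
    · simp [Test.Holds, NExpr.eval, hc, h.nat] at ht
      refine ⟨hc, h.setNat _ _ _ _, hp, fun v => ?_⟩
      simp only [Store.setNat_real]
      rw [hy v]
      grind
  · rintro s' ⟨h, hp, hy⟩
    refine ⟨h, fun c hc => ?_, fun v hv => ?_⟩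
    · rw [hp, hp₁]
      grind
    · rw [hy v]
      grind

namespace Store

/-- The station of each user. -/
def placement (s : Store) : ℕ → ℕ := fun v => s.nat 7 v 0

/-- The number of free places at each station. -/
def free (s : Store) : ℕ → ℕ := fun c => s.nat 6 c 0

/-- The rank of each station in the alternating tree, or `0`. -/
def rank (s : Store) : ℕ → ℕ := fun c => s.nat 8 c 0

/-- The user through whom each station of the alternating tree has been reached. -/
def parent (s : Store) : ℕ → ℕ := fun c => s.nat 9 c 0

/-- The price of each station. -/
def price (s : Store) : ℕ → ℝ := fun c => s.real 1 c 0

/-- The value of each user. -/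
def value (s : Store) : ℕ → ℝ := fun v => s.real 2 v 0

variable {s s' : Store}

@[simp] lemma placement_apply (i : ℕ) : s.placement i = s.nat 7 i 0 := rfl

lemma placement_congr (h : s'.nat 7 = s.nat 7) : s'.placement = s.placement := by
  unfold placement; rw [h]

@[simp] lemma free_apply (i : ℕ) : s.free i = s.nat 6 i 0 := rfl

lemma free_congr (h : s'.nat 6 = s.nat 6) : s'.free = s.free := by
  unfold free; rw [h]

@[simp] lemma rank_apply (i : ℕ) : s.rank i = s.nat 8 i 0 := rfl

lemma rank_congr (h : s'.nat 8 = s.nat 8) : s'.rank = s.rank := by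
  unfold rank; rw [h]

@[simp] lemma parent_apply (i : ℕ) : s.parent i = s.nat 9 i 0 := rfl

lemma parent_congr (h : s'.nat 9 = s.nat 9) : s'.parent = s.parent := by
  unfold parent; rw [h]

@[simp] lemma price_apply (i : ℕ) : s.price i = s.real 1 i 0 := rfl

lemma price_congr (h : s'.real 1 = s.real 1) : s'.price = s.price := by
  unfold price; rw [h]

@[simp] lemma value_apply (i : ℕ) : s.value i = s.real 2 i 0 := rfl

lemma value_congr (h : s'.real 2 = s.real 2) : s'.value = s.value := by
  unfold value; rw [h]

end Store

/-- One step of the search: add the edge of smallest slack to the alternating tree. Variable `13`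
holds the largest rank in the tree, and variable `18` is set when the new station has a free
place. -/
def growTree : Prog :=
  .seq minSlack <| .seq raisePrices <| .seq (assign 13 (.add (scalar 13) (.const 1))) <|
  .seq (assignEntry 8 (scalar 15) (scalar 13)) <| .seq (assignEntry 9 (scalar 15) (scalar 16)) <|
  .cond (.natLt (.const 0) (entry 6 (scalar 15))) (assign 18 (.const 1)) .nop

/-- The state of the search for an alternating path from the looking user to a free place. Until a
free place is found, all stations in the tree are full, and their ranks are consecutive. -/
structure Growing (m n : ℕ) (s : Store) : Prop where
  stations : s.nat 0 0 0 = m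
  users : s.nat 0 0 1 = n
  dual : Dual m n (s.real 0) s.placement s.free s.value s.price
  tree : Tree m n (s.real 0) s.placement s.value s.price s.rank s.parent
  placement_le : ∀ v < n, s.placement v ≤ m + 2
  free_ne : s.free m ≠ 0
  user_lt : s.nat 12 0 0 < n
  user_looking : s.placement (s.nat 12 0 0) = m + 1
  rank_le : ∀ c ≤ m + 1, s.rank c ≤ s.nat 13 0 0
  card : s.nat 18 0 0 = 0 →
    ((Finset.range (m + 1)).filter fun c => s.rank c ≠ 0).card + 1 = s.nat 13 0 0
  full : s.nat 18 0 0 = 0 → ∀ c ≤ m, s.rank c ≠ 0 → s.free c = 0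
  found : s.nat 18 0 0 ≠ 0 → s.nat 15 0 0 ≤ m ∧ s.rank (s.nat 15 0 0) ≠ 0 ∧
    s.free (s.nat 15 0 0) ≠ 0

/-- A step of the search keeps the invariant and adds one to the largest rank. -/
lemma run_growTree {m n D : ℕ} {s : Store} (hmD : m < D) (hnD : n < D) (h : Growing m n s)
    (hf : s.nat 18 0 0 = 0) :
    Run D growTree s fun s' => Same [8, 9, 10, 11, 13, 15, 16, 18] [1, 2, 3] s s' ∧
      Growing m n s' ∧ s'.nat 13 0 0 = s.nat 13 0 0 + 1 := by
  have hSm : s.nat 8 m 0 = 0 := by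
    by_contra hSm
    exact h.free_ne (h.full hf m le_rfl hSm)
  have hroot := h.tree.root
  have hlook := h.user_looking
  simp only [Store.rank_apply, Store.placement_apply] at hroot hlook
  refine .seq ((run_minSlack hmD hnD h.stations h.users h.user_lt hSm
    (by rw [hlook, hroot]; exact one_ne_zero)).mono fun s₁ h₁ => .seq ?_)
  have hs₁ := h₁.same
  refine (run_raisePrices hmD hnD (m := m) (n := n) (by simp [hs₁.nat, h.stations])
    (by simp [hs₁.nat, h.users])).mono fun s₂ ⟨hs₂, hp, hy⟩ => ?_
  simp only [hs₁.nat 8 (by decide), hs₁.nat 7 (by decide), hs₁.real 1 (by decide),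
    hs₁.real 2 (by decide)] at hp hy
  have hs₃ : Same [8, 9, 10, 11, 13, 15, 16, 18] [1, 2, 3] s s₂ :=
    ((Same.refl _ _ s).trans hs₁).trans hs₂
  generalize hc₀ : s₁.nat 15 0 0 = c₀ at *
  generalize hv₀ : s₁.nat 16 0 0 = v₀ at *
  have h15 : s₂.nat 15 0 0 = c₀ := by rw [hs₂.nat 15 (by decide), hc₀]
  have h16 : s₂.nat 16 0 0 = v₀ := by rw [hs₂.nat 16 (by decide), hv₀]
  have h8 : s₂.nat 8 = s.nat 8 := by rw [hs₂.nat 8 (by decide), hs₁.nat 8 (by decide)]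
  have h9 : s₂.nat 9 = s.nat 9 := hs₂.nat 9 (by decide) ▸ hs₁.nat 9 (by decide)
  have h13 : s₂.nat 13 = s.nat 13 := hs₂.nat 13 (by decide) ▸ hs₁.nat 13 (by decide)
  have h18 : s₂.nat 18 = s.nat 18 := hs₂.nat 18 (by decide) ▸ hs₁.nat 18 (by decide)
  have hle := h₁.station_le
  have hout := h₁.station_out
  have hlt := h₁.user_lt
  have hin := h₁.user_in
  have heq := h₁.eq
  simp only [hc₀, hv₀] at hle hout hlt hin heq
  have hav : s.nat 7 v₀ 0 ≤ m + 1 := by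
    have h1 := h.placement_le v₀ hlt
    have h2 : s.nat 7 v₀ 0 ≠ m + 2 := by
      intro he
      rw [he] at hin
      exact hin h.tree.idle
    rw [Store.placement_apply] at h1
    omega
  have hδ : 0 ≤ s₁.real 3 0 0 := by
    have := h.dual.le v₀ hlt hav c₀ hle
    rw [heq, slack]
    simp only [Store.value_apply, Store.price_apply] at this
    linarith
  have hdual : Dual m n (s.real 0) s.placement s.free s₂.value s₂.price :=
    h.dual.raise (S := s.rank) (h.full hf) hδ
      (fun c hc hSc v hv hSv => h₁.min c v ⟨hc, hv⟩ hSc hSv) hy hp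
  have htree : Tree m n (s.real 0) s.placement s₂.value s₂.price
      (fun c => if c = c₀ then s.nat 13 0 0 + 1 else s.nat 8 c 0)
      (fun c => if c = c₀ then v₀ else s.nat 9 c 0) :=
    h.tree.insert hle hout hlt hin heq (fun c hc => Nat.lt_succ_of_le (h.rank_le c hc))
      h.placement_le hy hp (fun _ => rfl) fun _ => rfl
  have hcard : ((Finset.range (m + 1)).filter fun c =>
      (if c = c₀ then s.nat 13 0 0 + 1 else s.nat 8 c 0) ≠ 0).card + 1 = s.nat 13 0 0 + 1 := by
    have hins : (Finset.range (m + 1)).filter (fun c =>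
        (if c = c₀ then s.nat 13 0 0 + 1 else s.nat 8 c 0) ≠ 0) =
        insert c₀ ((Finset.range (m + 1)).filter fun c => s.rank c ≠ 0) := by
      ext c
      simp only [Finset.mem_filter, Finset.mem_range, Finset.mem_insert]
      by_cases hcc : c = c₀
      · simp [hcc]
        omega
      · simp [hcc]
    rw [hins, Finset.card_insert_of_notMem (by intro hm; exact (Finset.mem_filter.1 hm).2 hout),
      h.card hf]
  refine .seq (.putNat (.seq (.putNat (.seq (.putNat ?_)))))
  simp only [NExpr.eval, h13]
  -- The store before variable `18` is set.
  generalize hs₄ : (((s₂.setNat 13 0 0 (s.nat 13 0 0 + 1)).setNat 8 _ 0 _).setNat 9 _ 0 _) = s₄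
  have hsame : Same [8, 9, 10, 11, 13, 15, 16, 18] [1, 2, 3] s s₄ :=
    hs₄ ▸ ((hs₃.setNat _ _ _ _).setNat _ _ _ _).setNat _ _ _ _
  have e8 : s₄.rank = fun c => if c = c₀ then s.nat 13 0 0 + 1 else s.nat 8 c 0 := by
    funext c
    simp [← hs₄, h15, h8]
  have e9 : s₄.parent = fun c => if c = c₀ then v₀ else s.nat 9 c 0 := by
    funext c
    simp [← hs₄, h15, h16, h9]
  have e13 : s₄.nat 13 0 0 = s.nat 13 0 0 + 1 := by simp [← hs₄]
  have e15 : s₄.nat 15 0 0 = c₀ := by simp [← hs₄, h15]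
  have e18 : s₄.nat 18 0 0 = 0 := by simp [← hs₄, h18, hf]
  have e1 : s₄.real 1 = s₂.real 1 := by simp [← hs₄]
  have e2 : s₄.real 2 = s₂.real 2 := by simp [← hs₄]
  have e7 : s₄.nat 7 = s.nat 7 := hsame.nat 7 (by decide)
  have e6 : s₄.nat 6 = s.nat 6 := hsame.nat 6 (by decide)
  have e12 : s₄.nat 12 = s.nat 12 := hsame.nat 12 (by decide)
  have hgrow : ∀ f, (f = 0 → s.free c₀ = 0) → (f ≠ 0 → s.free c₀ ≠ 0) →
      Growing m n (s₄.setNat 18 0 0 f) := by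
    intro f hf0 hf1
    have g6 : (s₄.setNat 18 0 0 f).free = s.free :=
      Store.free_congr (by simpa using e6)
    have g7 : (s₄.setNat 18 0 0 f).placement = s.placement :=
      Store.placement_congr (by simpa using e7)
    have g8 : (s₄.setNat 18 0 0 f).rank = s₄.rank := Store.rank_congr (by simp)
    have g9 : (s₄.setNat 18 0 0 f).parent = s₄.parent := Store.parent_congr (by simp)
    have g0 : s₄.real 0 = s.real 0 := hsame.real 0 (by decide)
    have g1 : (s₄.setNat 18 0 0 f).price = s₂.price := Store.price_congr e1
    have g2 : (s₄.setNat 18 0 0 f).value = s₂.value := Store.value_congr e2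
    refine ⟨?_, ?_, ?_, ?_, ?_, ?_, ?_, ?_, ?_, ?_, ?_, ?_⟩
    · simp [hsame.nat, h.stations]
    · simp [hsame.nat, h.users]
    · rw [g6, g7, g1, g2, Store.setNat_real, g0]
      exact hdual
    · rw [g7, g8, g9, e8, e9, g1, g2, Store.setNat_real, g0]
      exact htree
    · rw [g7]; exact h.placement_le
    · rw [g6]; exact h.free_ne
    · simpa [e12] using h.user_lt
    · rw [g7]; simpa [e12] using h.user_looking
    · intro c hc
      have := h.rank_le c hc
      rw [g8, e8]
      rw [Store.rank_apply] at this
      simp only [Store.setNat_nat_of_ne s₄ _ _ _ (show (13 : ℕ) ≠ 18 by decide), e13]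
      split_ifs <;> omega
    · intro _
      rw [g8, e8]
      simp only [Store.setNat_nat_of_ne s₄ _ _ _ (show (13 : ℕ) ≠ 18 by decide), e13]
      exact hcard
    · intro h0 c hc hSc
      rw [g6]
      rw [g8, e8] at hSc
      simp only at hSc
      by_cases hcc : c = c₀
      · rw [hcc]
        exact hf0 (by simpa using h0)
      · rw [if_neg hcc] at hSc
        exact h.full hf c hc hSc
    · intro h0
      rw [g6, g8, e8]
      simp only [Store.setNat_nat_of_ne s₄ _ _ _ (show (15 : ℕ) ≠ 18 by decide), e15]
      exact ⟨hle, by simp, hf1 (by simpa using h0)⟩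
  have e6' : s₄.nat 6 c₀ 0 = s.free c₀ := by rw [e6, Store.free_apply]
  refine .cond (fun ht => .putNat ?_) (fun ht => .nop ?_)
  · simp only [Test.Holds, NExpr.eval, e15, e6'] at ht
    exact ⟨hsame.setNat _ _ _ _, hgrow 1 (by simp) (by omega), by simpa using e13⟩
  · simp only [Test.Holds, NExpr.eval, e15, e6'] at ht
    refine ⟨hsame, ?_, e13⟩
    -- Variable `18` is `0` already, so this is `hgrow` for the value `0`.
    have : s₄.setNat 18 0 0 0 = s₄ := by
      cases s₄
      simp only [Store.setNat, Store.mk.injEq, and_true]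
      funext k i j
      split_ifs with hkij
      · rw [hkij.1, hkij.2.1, hkij.2.2]
        exact e18.symm
      · rfl
    rw [← this]
    exact hgrow 0 (by omega) (by simp)

/-- Start with the tree that consists of the place `m + 1` of the looking user, and let it grow
until a free place has been found. -/
def search : Prog :=
  .seq (forLoop 10 (.add numStations (.const 1)) (assignEntry 8 (scalar 10) (.const 0))) <|
  .seq (assignEntry 8 (.add numStations (.const 1)) (.const 1)) <|
  .seq (assign 13 (.const 1)) <| .seq (assign 18 (.const 0)) <|
  .loop (.natLt (scalar 18) (.const 1)) growTree

lemma run_search {m n D : ℕ} {s : Store} (hmD : m + 1 < D) (hnD : n < D)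
    (hm : s.nat 0 0 0 = m) (hn : s.nat 0 0 1 = n)
    (hdual : Dual m n (s.real 0) s.placement s.free s.value s.price)
    (hidle : s.rank (m + 2) = 0) (hle : ∀ v < n, s.placement v ≤ m + 2) (hfree : s.free m ≠ 0)
    (hk : s.nat 12 0 0 < n) (hlook : s.placement (s.nat 12 0 0) = m + 1) :
    Run D search s fun s' => Same [8, 9, 10, 11, 13, 15, 16, 18] [1, 2, 3] s s' ∧
      Growing m n s' ∧ s'.nat 18 0 0 ≠ 0 ∧ s'.nat 13 0 0 ≤ m + 2 := by
  refine .seq (.forLoop (fun i s' => Same [8, 10] [] s s' ∧ s'.nat 8 (m + 2) 0 = 0 ∧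
    ∀ c < i, s'.nat 8 c 0 = 0) (Nv := m + 1) (by omega) ?_ ?_ ?_ ?_)
  · rintro i s' ⟨h, -⟩
    simp [NExpr.eval, h.nat, hm]
  · exact ⟨(Same.refl _ _ s).setNat _ _ _ _, by simpa using hidle, by simp⟩
  · rintro i s' hi hc ⟨h, h1, h2⟩
    refine .putNat ⟨by simpa using hc, (h.setNat _ _ _ _).setNat _ _ _ _, ?_, fun c hci => ?_⟩
    · simp [NExpr.eval, h1]
    · have := h2 c
      simp only [NExpr.eval, hc, ne_eq, Nat.reduceEqDiff, not_false_eq_true,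
        Store.setNat_nat_of_ne, Store.setNat_nat_same, and_true]
      grind
  rintro s₁ ⟨h₁, hi₁, hz₁⟩
  refine .seq (.putNat (.seq (.putNat (.seq (.putNat ?_)))))
  simp only [NExpr.eval, h₁.nat 0 (by decide), hm]
  generalize hs₂ : ((s₁.setNat 8 (m + 1) 0 1).setNat 13 0 0 1).setNat 18 0 0 0 = s₂
  have h₂ : Same [8, 9, 10, 11, 13, 15, 16, 18] [1, 2, 3] s s₂ :=
    hs₂ ▸ ((((Same.refl _ _ s).trans h₁).setNat _ _ _ _).setNat _ _ _ _).setNat _ _ _ _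
  have e8 : ∀ c ≤ m, s₂.rank c = 0 := by
    intro c hc
    have := hz₁ c (by omega)
    have hcm : c ≠ m + 1 := by omega
    simp [← hs₂, this, hcm]
  have e1 : s₂.real 1 = s.real 1 := by simp [← hs₂, h₁.real]
  have e2 : s₂.real 2 = s.real 2 := by simp [← hs₂, h₁.real]
  have e13 : s₂.nat 13 0 0 = 1 := by simp [← hs₂]
  have e18 : s₂.nat 18 0 0 = 0 := by simp [← hs₂]
  have eroot : s₂.rank (m + 1) = 1 := by simp [← hs₂]
  have hgrow : Growing m n s₂ := by
    have g6 : s₂.free = s.free := Store.free_congr (h₂.nat 6 (by decide))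
    have g7 : s₂.placement = s.placement := Store.placement_congr (h₂.nat 7 (by decide))
    refine ⟨?_, ?_, ?_, ?_, ?_, ?_, ?_, ?_, ?_, ?_, ?_, ?_⟩
    · simp [h₂.nat, hm]
    · simp [h₂.nat, hn]
    · rw [g6, g7, Store.price_congr e1, Store.value_congr e2, h₂.real 0 (by decide)]
      exact hdual
    · refine ⟨eroot, by simp [← hs₂, hi₁], ?_, ?_, ?_, ?_⟩ <;>
        exact fun c hc hSc => absurd (e8 c hc) hSc
    · rw [g7]; exact hle
    · rw [g6]; exact hfree
    · simpa [h₂.nat] using hk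
    · rw [g7]; simpa [h₂.nat] using hlook
    · intro c hc
      rw [e13]
      rcases Nat.le_succ_iff.1 hc with hc | rfl
      · rw [e8 c hc]; exact zero_le_one
      · rw [eroot]
    · intro _
      rw [e13, Finset.filter_false_of_mem, Finset.card_empty]
      intro c hc
      rw [Finset.mem_range] at hc
      simpa using e8 c (by omega)
    · exact fun _ c hc hSc => absurd (e8 c hc) hSc
    · exact fun h0 => absurd e18 h0
  refine .loop (fun j s' => Same [8, 9, 10, 11, 13, 15, 16, 18] [1, 2, 3] s s' ∧
    Growing m n s' ∧ j + s'.nat 13 0 0 = m + 2) (N := m + 1) (by omega)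
    ⟨h₂, hgrow, by rw [e13]⟩ ?_ ?_
  · rintro j s' ⟨h1, h2, h3⟩ ht
    simp only [Test.Holds, NExpr.eval, Nat.lt_one_iff] at ht
    -- If all stations were in the tree, there would be no free place at the station `m`.
    have hj : j ≠ 0 := by
      rintro rfl
      have hcard := h2.card ht
      have hfull : (Finset.range (m + 1)).filter (fun c => s'.rank c ≠ 0) =
          Finset.range (m + 1) := by
        refine Finset.eq_of_subset_of_card_le (Finset.filter_subset _ _) ?_
        rw [Finset.card_range]
        omega
      have hmem : m ∈ (Finset.range (m + 1)).filter (fun c => s'.rank c ≠ 0) := by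
        rw [hfull]; simp
      exact h2.free_ne (h2.full ht m le_rfl (Finset.mem_filter.1 hmem).2)
    obtain ⟨j, rfl⟩ := Nat.exists_eq_succ_of_ne_zero hj
    refine ⟨j, rfl, (run_growTree (by omega) hnD h2 ht).mono ?_⟩
    rintro s'' ⟨h4, h5, h6⟩
    exact ⟨h1.trans h4, h5, by omega⟩
  · rintro j s' ⟨h1, h2, h3⟩ ht
    simp only [Test.Holds, NExpr.eval, Nat.lt_one_iff] at ht
    exact ⟨h1, h2, ht, by omega⟩

/-- Occupy the free place that has been found: along the path in the tree, every user moves on to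
the next station. -/
def augment : Prog :=
  .seq (assignEntry 6 (scalar 15) (.sub (entry 6 (scalar 15)) (.const 1))) <|
  .loop (.natLt (scalar 15) (.add numStations (.const 1))) <|
    .seq (assign 16 (entry 9 (scalar 15))) <| .seq (assign 17 (entry 7 (scalar 16))) <|
    .seq (assignEntry 7 (scalar 16) (scalar 15)) (assign 15 (scalar 17))

lemma run_augment {m n D : ℕ} {s : Store} {cap : ℕ → ℕ} (hmD : m + 2 ≤ D) (h : Growing m n s)
    (hf : s.nat 18 0 0 ≠ 0) (h13 : s.nat 13 0 0 ≤ m + 2)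
    (hbal : Balanced m n cap s.placement s.free (m + 2)) :
    Run D augment s fun s' => Same [6, 7, 15, 16, 17] [] s s' ∧
      Dual m n (s'.real 0) s'.placement s'.free s'.value s'.price ∧
      Balanced m n cap s'.placement s'.free (m + 1) ∧
      ∀ v < n, s'.placement v ≤ m + 1 ↔ s.placement v ≤ m + 1 := by
  obtain ⟨hc₀, hS₀, hr₀⟩ := h.found hf
  refine .seq (.putNat ?_)
  simp only [NExpr.eval]
  generalize hs₁ : s.setNat 6 (s.nat 15 0 0) 0 (s.nat 6 (s.nat 15 0 0) 0 - 1) = s₁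
  have h₁ : Same [6, 7, 15, 16, 17] [] s s₁ := hs₁ ▸ (Same.refl _ _ s).setNat _ _ _ _
  have g7 : s₁.placement = s.placement := Store.placement_congr (by simp [← hs₁])
  have g6 : ∀ c, s₁.free c = if c = s.nat 15 0 0 then s.free c - 1 else s.free c := by
    intro c
    simp only [← hs₁, Store.free_apply, Store.setNat_nat_same, and_true]
    split_ifs with hc
    · rw [hc]
    · rfl
  have h15 : s₁.nat 15 = s.nat 15 := by simp [← hs₁]
  have h8 : s₁.nat 8 = s.nat 8 := by simp [← hs₁]
  have h9 : s₁.nat 9 = s.nat 9 := by simp [← hs₁]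
  have gp : s₁.price = s.price := Store.price_congr (h₁.real 1 (by decide))
  have gv : s₁.value = s.value := Store.value_congr (h₁.real 2 (by decide))
  refine .loop (fun j s' => Same [6, 7, 15, 16, 17] [] s s' ∧
    Dual m n (s'.real 0) s'.placement s'.free s'.value s'.price ∧
    Path m n (s'.real 0) s'.placement s'.value s'.price s'.rank s'.parent (s'.nat 15 0 0) ∧
    Balanced m n cap s'.placement s'.free (s'.nat 15 0 0) ∧
    (∀ v < n, s'.placement v ≤ m + 1 ↔ s.placement v ≤ m + 1) ∧ s'.rank (s'.nat 15 0 0) ≤ j)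
    hmD ?_ ?_ ?_
  · refine ⟨h₁, ?_, ?_, ?_, ?_, ?_⟩
    · rw [g7, gp, gv, h₁.real 0 (by decide)]
      refine ⟨h.dual.le, h.dual.tight, h.dual.nonneg, fun c hc hr => h.dual.compl c hc ?_⟩
      rw [g6] at hr
      split_ifs at hr <;> omega
    · rw [g7, gp, gv, h₁.real 0 (by decide), Store.rank_congr h8, Store.parent_congr h9, h15]
      exact h.tree.path hc₀ hS₀
    · rw [g7, h15]
      refine ⟨hbal.le, fun c hc => ?_, ?_⟩
      · have := hbal.eq c hc
        rw [g6]
        split_ifs at this ⊢ <;> first | omega | (subst_vars; omega)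
      · have := hbal.looking
        split_ifs at this ⊢ <;> omega
    · rw [g7]; exact fun _ _ => Iff.rfl
    · rw [h15]
      rw [Store.rank_congr h8]
      exact (h.rank_le _ (by omega)).trans h13
  · rintro j s' ⟨h1, hd, hpath, hb, hact, hj⟩ ht
    have h0 : s'.nat 0 0 0 = m := by rw [h1.nat 0 (by decide), h.stations]
    simp only [Test.Holds, NExpr.eval, h0] at ht
    have hcm : s'.nat 15 0 0 ≤ m := by omega
    have hpos := hpath.pos
    obtain ⟨j, rfl⟩ := Nat.exists_eq_succ_of_ne_zero (n := j) (by omega)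
    refine ⟨j, rfl, .seq (.putNat (.seq (.putNat (.seq (.putNat (.putNat ?_))))))⟩
    simp only [NExpr.eval, Store.setNat_nat_same, and_self, if_true]
    generalize hc : s'.nat 15 0 0 = c at *
    generalize hv : s'.nat 9 c 0 = v
    simp only [ne_eq, Nat.reduceEqDiff, not_false_eq_true, Store.setNat_nat_of_ne, hc,
      Store.setNat_nat_same, and_self, if_true]
    generalize hs₂ : (((s'.setNat 16 0 0 v).setNat 17 0 0 (s'.nat 7 v 0)).setNat 7 v 0 c).setNat
      15 0 0 (s'.nat 7 v 0) = s₂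
    have ha : ∀ u, s₂.placement u = if u = v then c else s'.placement u := by
      intro u
      simp [← hs₂]
    have e6 : s₂.free = s'.free := Store.free_congr (by simp [← hs₂])
    have e8 : s₂.rank = s'.rank := Store.rank_congr (by simp [← hs₂])
    have e9 : s₂.parent = s'.parent := Store.parent_congr (by simp [← hs₂])
    have er : s₂.real = s'.real := by simp [← hs₂]
    have ep : s₂.price = s'.price := Store.price_congr (by rw [er])
    have ev : s₂.value = s'.value := Store.value_congr (by rw [er])
    have hpv : s'.parent c = v := hv
    have hvn : v < n := hpv ▸ hpath.lt c hcm hpos le_rfl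
    have hpath' := hpath.step hcm hb.le (a' := s₂.placement) (by rw [hpv]; exact ha)
    rw [hpv] at hpath'
    have htight := hpath.tight c hcm hpos le_rfl
    have hrank := hpath.rank_lt c hcm hpos le_rfl
    rw [hpv] at htight hrank
    refine ⟨?_, ?_, ?_, ?_, ?_, ?_⟩
    · rw [← hs₂]
      exact (((h1.setNat _ _ _ _).setNat _ _ _ _).setNat _ _ _ _).setNat _ _ _ _
    · rw [e6, ep, ev, er]
      exact hd.move hpath'.le htight ha
    · rw [e8, e9, ep, ev, er]
      exact hpath'
    · rw [e6]
      exact hb.move hvn hcm ha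
    · intro u hu
      rw [ha, ← hact u hu]
      split_ifs with huv
      · rw [huv]
        have := hpath'.le
        constructor <;> intro <;> omega
      · rfl
    · rw [e8]
      exact Nat.lt_succ_iff.1 (hrank.trans_le hj)
  · rintro j s' ⟨h1, hd, hpath, hb, hact, hj⟩ ht
    have h0 : s'.nat 0 0 0 = m := by rw [h1.nat 0 (by decide), h.stations]
    simp only [Test.Holds, NExpr.eval, h0] at ht
    have hc : s'.nat 15 0 0 = m + 1 := by
      have := hpath.le
      omega
    rw [hc] at hb
    exact ⟨h1, hd, hb, hact⟩

/-! ### Placing the users one by one -/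

/-- Place the user in variable `12`. Its value starts as the largest profit that the current prices
leave to it, and it looks for a station from the place `m + 1`. -/
def placeUser : Prog :=
  .seq (assignReal 2 (scalar 12) .zero) <|
  .seq (forLoop 10 numStations <|
    .cond (.realLt (realEntry 2 (scalar 12))
        (.sub (.get 0 (scalar 10) (scalar 12)) (realEntry 1 (scalar 10))))
      (assignReal 2 (scalar 12)
        (.sub (.get 0 (scalar 10) (scalar 12)) (realEntry 1 (scalar 10)))) .nop) <|
  .seq (assignEntry 7 (scalar 12) (.add numStations (.const 1))) <|
  .seq search augment

/-- The state between two runs of `placeUser`: exactly the users in `A` have been placed. With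
the argument `m + 1`, `balanced` says that no user is looking for a station. -/
structure Placed (m n : ℕ) (cap : ℕ → ℕ) (A : ℕ → Prop) (s : Store) : Prop where
  stations : s.nat 0 0 0 = m
  users : s.nat 0 0 1 = n
  weight : ∀ v, s.real 0 m v = 0
  dual : Dual m n (s.real 0) s.placement s.free s.value s.price
  balanced : Balanced m n cap s.placement s.free (m + 1)
  idle : s.rank (m + 2) = 0
  active : ∀ v < n, s.placement v ≤ m + 1 ↔ A v

lemma Placed.congr {m n : ℕ} {cap : ℕ → ℕ} {A B : ℕ → Prop} {s : Store}
    (h : Placed m n cap A s) (hAB : ∀ v, A v ↔ B v) : Placed m n cap B s :=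
  { h with active := fun v hv => (h.active v hv).trans (hAB v) }

lemma Placed.setNat {m n : ℕ} {cap : ℕ → ℕ} {A : ℕ → Prop} {s : Store}
    (h : Placed m n cap A s) (i j v : ℕ) : Placed m n cap A (s.setNat 12 i j v) :=
  ⟨h.stations, h.users, h.weight, h.dual, h.balanced, h.idle, h.active⟩

lemma run_placeUser {m n D k : ℕ} {s : Store} {cap : ℕ → ℕ} {A : ℕ → Prop} (hmD : m + 2 ≤ D)
    (hnD : n < D) (hcap : cap m = n + 1) (h : Placed m n cap A s) (hk : s.nat 12 0 0 = k)
    (hkn : k < n) (hA : ¬ A k) :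
    Run D placeUser s fun s' =>
      Same [6, 7, 8, 9, 10, 11, 13, 15, 16, 17, 18] [1, 2, 3] s s' ∧
      Placed m n cap (fun v => v = k ∨ A v) s' := by
  have hak : s.placement k = m + 2 := by
    have h1 := h.balanced.le k hkn
    have h2 := mt (h.active k hkn).1 hA
    omega
  refine .seq (.putReal (.seq ?_))
  refine .forLoop (fun i s' => Same [10] [2] s s' ∧ (∀ v, v ≠ k → s'.value v = s.value v) ∧
    0 ≤ s'.value k ∧ ∀ c < i, s.real 0 c k - s.price c ≤ s'.value k) (Nv := m)
    (by omega) ?_ ?_ ?_ ?_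
  · rintro i s' ⟨h1, -⟩
    simp [NExpr.eval, h1.nat, h.stations]
  · refine ⟨((Same.refl _ _ s).setReal _ _ _ _).setNat _ _ _ _, ?_, ?_, ?_⟩ <;>
      simp +contextual [NExpr.eval, RExpr.eval, hk]
  · rintro c s' hc hi ⟨h1, h2, h3, h4⟩
    have hk' : s'.nat 12 0 0 = k := by rw [h1.nat 12 (by decide), hk]
    simp only [Store.value_apply, Store.price_apply] at h2 h3 h4
    refine .cond (fun ht => .putReal ?_) (fun ht => .nop ?_)
    · simp only [Test.Holds, NExpr.eval, RExpr.eval, hi, hk', h1.real 0 (by decide),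
        h1.real 1 (by decide)] at ht ⊢
      refine ⟨by simpa using hi, (h1.setReal _ _ _ _).setNat _ _ _ _, ?_, ?_, ?_⟩
      · intro v hv
        simp [hv, h2 v hv]
      · simp only [Store.value_apply, Store.setNat_real, Store.setReal_real_same, and_self,
          if_true]
        exact h3.trans ht.le
      · intro c' hc'
        simp only [Store.value_apply, Store.price_apply, Store.setNat_real,
          Store.setReal_real_same, and_self, if_true]
        rcases Nat.lt_succ_iff_lt_or_eq.1 hc' with hc' | rfl
        · exact (h4 c' hc').trans ht.le
        · rfl
    · simp only [Test.Holds, NExpr.eval, RExpr.eval, hi, hk', h1.real 0 (by decide),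
        h1.real 1 (by decide), not_lt] at ht
      refine ⟨hi, h1.setNat _ _ _ _, h2, h3, ?_⟩
      intro c' hc'
      rcases Nat.lt_succ_iff_lt_or_eq.1 hc' with hc' | rfl
      · exact h4 c' hc'
      · exact ht
  rintro s₁ ⟨h₁, hy, hy₀, hyk⟩
  refine .seq (.putNat (.seq ?_))
  simp only [NExpr.eval, h₁.nat 12 (by decide), h₁.nat 0 (by decide), hk, h.stations]
  generalize hs₂ : s₁.setNat 7 k 0 (m + 1) = s₂
  have h₂ : Same [6, 7, 8, 9, 10, 11, 13, 15, 16, 17, 18] [1, 2, 3] s s₂ :=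
    hs₂ ▸ ((Same.refl _ _ s).trans h₁).setNat _ _ _ _
  have g6 : s₂.free = s.free := Store.free_congr (by simp [← hs₂, h₁.nat])
  have g7 : ∀ v, s₂.placement v = if v = k then m + 1 else s.placement v := by
    intro v
    simp [← hs₂, h₁.nat]
  have gv : s₂.value = s₁.value := Store.value_congr (by simp [← hs₂])
  have gp : s₂.price = s.price := Store.price_congr (by simp [← hs₂, h₁.real])
  have h12 : s₂.nat 12 0 0 = k := by rw [h₂.nat 12 (by decide), hk]
  have hmove := load_move hkn g7
  have hbal : Balanced m n cap s₂.placement s₂.free (m + 2) := by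
    refine ⟨fun v hv => ?_, fun c hc => ?_, ?_⟩
    · have := h.balanced.le v hv
      rw [g7]
      split_ifs <;> omega
    · have := h.balanced.eq c hc
      have := hmove c
      rw [g6]
      split_ifs at * <;> omega
    · have := h.balanced.looking
      have := hmove (m + 1)
      split_ifs at * <;> omega
  have hdual : Dual m n (s₂.real 0) s₂.placement s₂.free s₂.value s₂.price := by
    rw [g6, gv, gp, h₂.real 0 (by decide)]
    refine h.dual.join (v₀ := k) (fun c hc => ?_) hy g7
    rcases hc.lt_or_eq with hc | rfl
    · have := hyk c hc
      linarith
    · have := h.dual.nonneg c le_rfl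
      rw [h.weight]
      linarith
  have hfree : s₂.free m ≠ 0 := by
    have h1 := hbal.eq m le_rfl
    have h2 := load_le n s₂.placement m
    rw [if_neg (by omega), hcap] at h1
    omega
  refine (run_search (m := m) (n := n) (by omega) hnD (by rw [h₂.nat 0 (by decide), h.stations])
    (by rw [h₂.nat 0 (by decide), h.users]) hdual ?_ hbal.le hfree
    (by rw [h12]; exact hkn) (by rw [h12, g7, if_pos rfl])).mono ?_
  · rw [Store.rank_congr (s := s) (by simp [← hs₂, h₁.nat]), h.idle]
  rintro s₃ ⟨h₃, hgrow, hf, h13⟩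
  have f7 : s₃.placement = s₂.placement := Store.placement_congr (h₃.nat 7 (by decide))
  have f6 : s₃.free = s₂.free := Store.free_congr (h₃.nat 6 (by decide))
  refine (run_augment hmD hgrow hf h13 (by rw [f6, f7]; exact hbal)).mono ?_
  rintro s₄ ⟨h₄, hd, hb, hact⟩
  have hs : Same [6, 7, 8, 9, 10, 11, 13, 15, 16, 17, 18] [1, 2, 3] s s₄ :=
    (h₂.trans h₃).trans h₄
  refine ⟨hs, ?_, ?_, ?_, hd, hb, ?_, ?_⟩
  · rw [hs.nat 0 (by decide), h.stations]
  · rw [hs.nat 0 (by decide), h.users]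
  · rw [hs.real 0 (by decide)]; exact h.weight
  · rw [Store.rank_congr (h₄.nat 8 (by decide)), hgrow.tree.idle]
  · intro v hv
    rw [hact v hv, f7, g7]
    split_ifs with hvk
    · simp [hvk]
    · rw [h.active v hv]
      simp [hvk]

/-! ### Input and output -/

/-- Store the sum of the values of `e`, for `k = 0, …, N - 1`, in variable `t`. -/
def sumLoop (k t : ℕ) (N e : NExpr) : Prog :=
  .seq (assign t (.const 0)) (forLoop k N (assign t (.add (scalar t) e)))

lemma run_sumLoop {D k t : ℕ} {N e : NExpr} {s : Store} {Nv : ℕ} {f : ℕ → ℕ} (hkt : k ≠ t)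
    (hD : Nv ≤ D) (hN : ∀ s', Same [k, t] [] s s' → N.eval s' = Nv)
    (he : ∀ s' i, Same [k, t] [] s s' → s'.nat k 0 0 = i → e.eval s' = f i) :
    Run D (sumLoop k t N e) s fun s' =>
      Same [k, t] [] s s' ∧ s'.nat t 0 0 = ∑ i ∈ Finset.range Nv, f i := by
  refine .seq (.putNat (.forLoop (fun j s' => Same [k, t] [] s s' ∧
    s'.nat t 0 0 = ∑ i ∈ Finset.range j, f i) hD (fun j s' h => hN s' h.1) ?_ ?_ fun _ h => h))
  · exact ⟨((Same.refl _ _ s).setNat _ _ _ _ (by simp)).setNat _ _ _ _ (by simp),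
      by simp [hkt.symm, NExpr.eval]⟩
  · rintro j s' hj hk ⟨h1, h2⟩
    refine .putNat ⟨by simpa [hkt] using hk,
      (h1.setNat _ _ _ _ (by simp)).setNat _ _ _ _ (by simp), ?_⟩
    simp [hkt.symm, NExpr.eval, h2, he s' j h1 hk, Finset.sum_range_succ]

/-- Copy the old association of the users that do not ask for reassociation to the output. -/
def copyFixed : Prog :=
  forLoop 10 numStations <| forLoop 11 numUsers <|
    .cond (.natLt (entry 2 (scalar 11)) (.const 1))
      (.putNat 5 (scalar 10) (scalar 11) (.get 3 (scalar 10) (scalar 11))) .nop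

lemma run_copyFixed {m n D : ℕ} {s : Store} (hmD : m ≤ D) (hnD : n ≤ D) (hm : s.nat 0 0 0 = m)
    (hn : s.nat 0 0 1 = n) (h5 : ∀ b u, s.nat 5 b u = 0) :
    Run D copyFixed s fun s' => Same [5, 10, 11] [] s s' ∧ ∀ b < m, ∀ u < n,
      s'.nat 5 b u = if s.nat 2 u 0 = 0 then s.nat 3 b u else 0 := by
  refine .forLoop (fun i s' => Same [5, 10, 11] [] s s' ∧ ∀ b u,
    s'.nat 5 b u = if (b < i ∧ u < n) ∧ s.nat 2 u 0 = 0 then s.nat 3 b u else 0) hmD ?_ ?_ ?_ ?_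
  · rintro i s' ⟨h, -⟩
    simp [NExpr.eval, h.nat, hm]
  · exact ⟨(Same.refl _ _ s).setNat _ _ _ _, by simp [h5]⟩
  · rintro i s₁ hi hc ⟨h, hx⟩
    refine .forLoop (fun j s' => s'.nat 10 0 0 = i ∧ Same [5, 10, 11] [] s s' ∧ ∀ b u,
      s'.nat 5 b u = if (b < i ∧ u < n ∨ b = i ∧ u < j) ∧ s.nat 2 u 0 = 0
        then s.nat 3 b u else 0) hnD ?_ ?_ ?_ ?_
    · rintro j s' ⟨-, h, -⟩
      simp [NExpr.eval, h.nat, hn]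
    · exact ⟨by simpa using hc, h.setNat _ _ _ _, by simp [hx]⟩
    · rintro j s₂ hj hu ⟨hc₂, h₂, hx₂⟩
      refine .cond (fun ht => .putNat ?_) (fun ht => .nop ?_)
      · simp only [Test.Holds, NExpr.eval, hu, h₂.nat 2 (by decide), Nat.lt_one_iff] at ht
        refine ⟨by simpa using hu, by simpa using hc₂, (h₂.setNat _ _ _ _).setNat _ _ _ _, ?_⟩
        intro b u
        simp only [NExpr.eval, hu, hc₂, h₂.nat 3 (by decide), ne_eq, Nat.reduceEqDiff,
          not_false_eq_true, Store.setNat_nat_of_ne, Store.setNat_nat_same, hx₂]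
        grind
      · simp only [Test.Holds, NExpr.eval, hu, h₂.nat 2 (by decide), Nat.lt_one_iff] at ht
        refine ⟨hu, by simpa using hc₂, h₂.setNat _ _ _ _, ?_⟩
        intro b u
        simp only [ne_eq, Nat.reduceEqDiff, not_false_eq_true, Store.setNat_nat_of_ne, hx₂]
        grind
    · rintro s₂ ⟨hc₂, h₂, hx₂⟩
      refine ⟨hc₂, h₂.setNat _ _ _ _, ?_⟩
      intro b u
      simp only [ne_eq, Nat.reduceEqDiff, not_false_eq_true, Store.setNat_nat_of_ne, hx₂]
      grind
  · rintro s' ⟨h, hx⟩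
    refine ⟨h, fun b hb u hu => ?_⟩
    simp [hx, hb, hu]

/-- Compute the numbers of places that the fixed users leave free, and clear the answer `4` if they
exceed the capacity of a station. -/
def initFree : Prog :=
  forLoop 10 numStations <|
    .seq (sumLoop 11 19 numUsers (.get 5 (scalar 10) (scalar 11))) <|
    .seq (.cond (.natLt (entry 1 (scalar 10)) (scalar 19)) (assign 4 (.const 0)) .nop) <|
    assignEntry 6 (scalar 10) (.sub (entry 1 (scalar 10)) (scalar 19))

lemma run_initFree {m n D : ℕ} {s : Store} (hmD : m ≤ D) (hnD : n ≤ D) (hm : s.nat 0 0 0 = m)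
    (hn : s.nat 0 0 1 = n) (h4 : s.nat 4 0 0 = 1) :
    Run D initFree s fun s' => Same [4, 6, 10, 11, 19] [] s s' ∧
      (∀ b < m, s'.free b = s.nat 1 b 0 - ∑ u ∈ Finset.range n, s.nat 5 b u) ∧
      s'.flag ≤ 1 ∧
      (s'.flag = 1 ↔ ∀ b < m, ∑ u ∈ Finset.range n, s.nat 5 b u ≤ s.nat 1 b 0) := by
  refine .forLoop (fun i s' => Same [4, 6, 10, 11, 19] [] s s' ∧
      (∀ b < i, s'.free b = s.nat 1 b 0 - ∑ u ∈ Finset.range n, s.nat 5 b u) ∧ s'.flag ≤ 1 ∧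
      (s'.flag = 1 ↔ ∀ b < i, ∑ u ∈ Finset.range n, s.nat 5 b u ≤ s.nat 1 b 0))
    hmD ?_ ?_ ?_ fun _ h => h
  · rintro i s' ⟨h, -⟩
    simp [NExpr.eval, h.nat, hm]
  · exact ⟨(Same.refl _ _ s).setNat _ _ _ _, by simp [Store.flag, h4]⟩
  rintro i s₁ hi hc ⟨h₁, hr₁, hf₁, hf₁'⟩
  refine .seq ((run_sumLoop (f := fun u => s.nat 5 i u) (by decide) hnD ?_ ?_).mono ?_)
  · intro s' h
    simp [NExpr.eval, h.nat, h₁.nat, hn]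
  · intro s' u h hu
    simp [NExpr.eval, h.nat, h₁.nat, hu, hc]
  rintro s₂ ⟨h₂, ht⟩
  have hs₂ : Same [4, 6, 10, 11, 19] [] s s₂ := h₁.trans h₂
  have hc₂ : s₂.nat 10 0 0 = i := by
    rw [h₂.nat 10 (by decide), hc]
  have hr₂ : s₂.free = s₁.free := Store.free_congr (h₂.nat 6 (by decide))
  have hf₂ : s₂.flag = s₁.flag := by rw [Store.flag, Store.flag, h₂.nat 4 (by decide)]
  rw [← hf₂] at hf₁ hf₁'
  rw [← hr₂] at hr₁
  have hsplit : (∀ b < i + 1, ∑ u ∈ Finset.range n, s.nat 5 b u ≤ s.nat 1 b 0) ↔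
      (∀ b < i, ∑ u ∈ Finset.range n, s.nat 5 b u ≤ s.nat 1 b 0) ∧
      ∑ u ∈ Finset.range n, s.nat 5 i u ≤ s.nat 1 i 0 := Nat.forall_lt_succ_right
  have hfree : ∀ s₃ : Store, s₃.free = s₂.free → ∀ b < i + 1,
      ((s₃.setNat 6 i 0 (s.nat 1 i 0 - ∑ u ∈ Finset.range n, s.nat 5 i u)).setNat 10 0 0
        (i + 1)).free b = s.nat 1 b 0 - ∑ u ∈ Finset.range n, s.nat 5 b u := by
    intro s₃ h3 b hb
    simp only [Store.free_apply, ne_eq, Nat.reduceEqDiff, not_false_eq_true,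
      Store.setNat_nat_of_ne, Store.setNat_nat_same, and_true]
    split_ifs with hbi
    · rw [hbi]
    · exact (congrFun h3 b).trans (hr₁ b (by omega))
  refine .seq (.cond (fun hlt => .putNat (.putNat ?_)) (fun hlt => .nop (.putNat ?_)))
  · simp only [Test.Holds, NExpr.eval, hc₂, hs₂.nat 1 (by decide), ht] at hlt
    simp only [NExpr.eval, ne_eq, Nat.reduceEqDiff, not_false_eq_true, OfNat.one_ne_ofNat,
      Store.setNat_nat_of_ne, hc₂, hs₂.nat 1 (by decide), ht]
    refine ⟨by simp, ((hs₂.setNat _ _ _ _).setNat _ _ _ _).setNat _ _ _ _,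
      hfree _ (Store.free_congr (by simp)), by simp [Store.flag], ?_⟩
    rw [hsplit]
    simp [Store.flag]
    intro _
    exact hlt
  · simp only [Test.Holds, NExpr.eval, hc₂, hs₂.nat 1 (by decide), ht, not_lt] at hlt
    simp only [NExpr.eval, hc₂, hs₂.nat 1 (by decide), ht]
    refine ⟨by simpa using hc₂, (hs₂.setNat _ _ _ _).setNat _ _ _ _, hfree _ rfl, ?_, ?_⟩
    · simpa [Store.flag] using hf₁
    · rw [hsplit, ← hf₁']
      simp [Store.flag, hlt]

/-- Clear the answer `4` if a fixed user has more than one association, and mark all users as not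
taking part. -/
def initUsers : Prog :=
  forLoop 11 numUsers <|
    .seq (sumLoop 10 19 numStations (.get 5 (scalar 10) (scalar 11))) <|
    .seq (.cond (.natLt (.const 1) (scalar 19)) (assign 4 (.const 0)) .nop) <|
    assignEntry 7 (scalar 11) (.add numStations (.const 2))

lemma run_initUsers {m n D : ℕ} {s : Store} (hmD : m ≤ D) (hnD : n ≤ D) (hm : s.nat 0 0 0 = m)
    (hn : s.nat 0 0 1 = n) (h4 : s.flag ≤ 1) :
    Run D initUsers s fun s' => Same [4, 7, 10, 11, 19] [] s s' ∧
      (∀ u < n, s'.placement u = m + 2) ∧ s'.flag ≤ 1 ∧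
      (s'.flag = 1 ↔ s.flag = 1 ∧ ∀ u < n, ∑ b ∈ Finset.range m, s.nat 5 b u ≤ 1) := by
  refine .forLoop (fun i s' => Same [4, 7, 10, 11, 19] [] s s' ∧
      (∀ u < i, s'.placement u = m + 2) ∧ s'.flag ≤ 1 ∧
      (s'.flag = 1 ↔ s.flag = 1 ∧ ∀ u < i, ∑ b ∈ Finset.range m, s.nat 5 b u ≤ 1))
    hnD ?_ ?_ ?_ fun _ h => h
  · rintro i s' ⟨h, -⟩
    simp [NExpr.eval, h.nat, hn]
  · refine ⟨(Same.refl _ _ s).setNat _ _ _ _, by simp, ?_, ?_⟩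
    · simpa [Store.flag] using h4
    · simp [Store.flag]
  rintro i s₁ hi hc ⟨h₁, hr₁, hf₁, hf₁'⟩
  refine .seq ((run_sumLoop (f := fun b => s.nat 5 b i) (by decide) hmD ?_ ?_).mono ?_)
  · intro s' h
    simp [NExpr.eval, h.nat, h₁.nat, hm]
  · intro s' u h hu
    simp [NExpr.eval, h.nat, h₁.nat, hu, hc]
  rintro s₂ ⟨h₂, ht⟩
  have hs₂ : Same [4, 7, 10, 11, 19] [] s s₂ := h₁.trans h₂
  have hc₂ : s₂.nat 11 0 0 = i := by
    rw [h₂.nat 11 (by decide), hc]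
  have hr₂ : s₂.placement = s₁.placement := Store.placement_congr (h₂.nat 7 (by decide))
  have hf₂ : s₂.flag = s₁.flag := by rw [Store.flag, Store.flag, h₂.nat 4 (by decide)]
  rw [← hf₂] at hf₁ hf₁'
  rw [← hr₂] at hr₁
  have hsplit : (∀ u < i + 1, ∑ b ∈ Finset.range m, s.nat 5 b u ≤ 1) ↔
      (∀ u < i, ∑ b ∈ Finset.range m, s.nat 5 b u ≤ 1) ∧
      ∑ b ∈ Finset.range m, s.nat 5 b i ≤ 1 := Nat.forall_lt_succ_right
  have hplace : ∀ s₃ : Store, s₃.placement = s₂.placement → ∀ u < i + 1,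
      ((s₃.setNat 7 i 0 (m + 2)).setNat 11 0 0 (i + 1)).placement u = m + 2 := by
    intro s₃ h3 u hu
    simp only [Store.placement_apply, ne_eq, Nat.reduceEqDiff, not_false_eq_true,
      Store.setNat_nat_of_ne, Store.setNat_nat_same, and_true]
    split_ifs with hui
    · rfl
    · exact (congrFun h3 u).trans (hr₁ u (by omega))
  refine .seq (.cond (fun hlt => .putNat (.putNat ?_)) (fun hlt => .nop (.putNat ?_)))
  · simp only [Test.Holds, NExpr.eval, ht] at hlt
    simp only [NExpr.eval, ne_eq, Nat.reduceEqDiff, not_false_eq_true, OfNat.zero_ne_ofNat,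
      Store.setNat_nat_of_ne, hc₂, hs₂.nat 0 (by decide), hm]
    refine ⟨by simp, ((hs₂.setNat _ _ _ _).setNat _ _ _ _).setNat _ _ _ _,
      hplace _ (Store.placement_congr (by simp)), by simp [Store.flag], ?_⟩
    rw [hsplit]
    simp [Store.flag]
    intro _ _
    exact hlt
  · simp only [Test.Holds, NExpr.eval, ht, not_lt] at hlt
    simp only [NExpr.eval, hc₂, hs₂.nat 0 (by decide), hm]
    refine ⟨by simpa using hc₂, (hs₂.setNat _ _ _ _).setNat _ _ _ _, hplace _ rfl, ?_, ?_⟩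
    · simpa [Store.flag] using hf₁
    · rw [hsplit, ← and_assoc, ← hf₁']
      simp [Store.flag, hlt]

/-- Write the placement of the asking users to the output; the association of the fixed users is
there already. -/
def writeOutput : Prog :=
  forLoop 11 numUsers <|
    .cond (.natLt (entry 7 (scalar 11)) numStations)
      (.putNat 5 (entry 7 (scalar 11)) (scalar 11) (.const 1)) .nop

lemma run_writeOutput {m n D : ℕ} {s : Store} (hnD : n ≤ D) (hm : s.nat 0 0 0 = m)
    (hn : s.nat 0 0 1 = n) :
    Run D writeOutput s fun s' => Same [5, 11] [] s s' ∧ ∀ b < m, ∀ u < n,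
      s'.nat 5 b u = if s.placement u = b then 1 else s.nat 5 b u := by
  refine .forLoop (fun i s' => Same [5, 11] [] s s' ∧ ∀ b < m, ∀ u,
      s'.nat 5 b u = if u < i ∧ s.placement u = b then 1 else s.nat 5 b u) hnD ?_ ?_ ?_ ?_
  · rintro i s' ⟨h, -⟩
    simp [NExpr.eval, h.nat, hn]
  · exact ⟨(Same.refl _ _ s).setNat _ _ _ _, by simp⟩
  · rintro i s' hi hu ⟨h, hx⟩
    refine .cond (fun ht => .putNat ?_) (fun ht => .nop ?_)
    · simp only [Test.Holds, NExpr.eval, hu, h.nat 7 (by decide), h.nat 0 (by decide), hm] at ht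
      refine ⟨by simpa using hu, (h.setNat _ _ _ _).setNat _ _ _ _, ?_⟩
      intro b hb u
      simp only [NExpr.eval, hu, h.nat 7 (by decide), ne_eq, Nat.reduceEqDiff,
        not_false_eq_true, Store.setNat_nat_of_ne, Store.setNat_nat_same, hx b hb u,
        Store.placement_apply]
      grind
    · simp only [Test.Holds, NExpr.eval, hu, h.nat 7 (by decide), h.nat 0 (by decide), hm] at ht
      refine ⟨hu, h.setNat _ _ _ _, ?_⟩
      intro b hb u
      simp only [ne_eq, Nat.reduceEqDiff, not_false_eq_true, Store.setNat_nat_of_ne, hx b hb u,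
        Store.placement_apply]
      grind
  · rintro s' ⟨h, hx⟩
    refine ⟨h, fun b hb u hu => ?_⟩
    simp only [hx b hb, hu, true_and]

/-! ### The whole program -/

/-- The association of the users that do not ask for reassociation. -/
def fixedPart {m n : ℕ} (I : UAInstance (Fin m) (Fin n)) (b u : ℕ) : ℕ :=
  if I.inputNat 2 u 0 = 0 then I.inputNat 3 b u else 0

section

variable {m n : ℕ} (I : UAInstance (Fin m) (Fin n))

lemma fixedPart_of_asks {b : ℕ} {u : Fin n} (hu : I.asks u = true) : fixedPart I b u = 0 := by
  simp [fixedPart, UAInstance.inputNat, hu]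

lemma fixedPart_of_not_asks (b : Fin m) {u : Fin n} (hu : I.asks u = false) :
    fixedPart I b u = (I.prev b u).toNat := by
  simp [fixedPart, UAInstance.inputNat, hu]

lemma fixedPart_le {y : Fin m → Fin n → ℕ} (hy : I.IsFeasible y) (b : Fin m) (u : Fin n) :
    fixedPart I b u ≤ y b u := by
  cases hu : I.asks u with
  | false => rw [fixedPart_of_not_asks I b hu, hy.continuity u hu b]
  | true => rw [fixedPart_of_asks I hu]; exact Nat.zero_le _

/-- Placing the asking users at prices that satisfy complementary slackness, and keeping the old
association of the others, solves the problem. -/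
lemma solves_of_dual {s : Store} {cap a r : ℕ → ℕ} {y p : ℕ → ℝ}
    (hx : ∀ b < m, ∀ u < n, s.nat 5 b u = if a u = b then 1 else fixedPart I b u)
    (hflag : s.flag ≤ 1)
    (hflag' : s.flag = 1 ↔ (∀ b < m, ∑ u ∈ Finset.range n, fixedPart I b u ≤ I.inputNat 1 b 0) ∧
      ∀ u < n, ∑ b ∈ Finset.range m, fixedPart I b u ≤ 1)
    (hbal : Balanced m n cap a r (m + 1)) (hcapm : cap m = n + 1)
    (hcap : ∀ b < m, cap b = I.inputNat 1 b 0 - ∑ u ∈ Finset.range n, fixedPart I b u)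
    (hdual : Dual m n (I.inputReal 0) a r y p)
    (hact : ∀ u < n, a u ≤ m + 1 ↔ I.inputNat 2 u 0 ≠ 0) : s.Solves I := by
  have hact' : ∀ u : Fin n, a u ≤ m + 1 ↔ I.asks u = true := by
    intro u
    rw [hact u u.2]
    simp [UAInstance.inputNat]
  have hle : ∀ u : Fin n, I.asks u = true → a u ≤ m := by
    intro u hu
    have h1 := (hact' u).2 hu
    have h2 := load_eq_zero.1 (by simpa using hbal.looking : load n a (m + 1) = 0) u u.2
    omega
  -- The station `m` has a free place, so staying without a base station costs nothing.
  have hpm : p m = 0 := by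
    refine hdual.compl m le_rfl ?_
    have h1 := hbal.eq m le_rfl
    have h2 := load_le n a m
    rw [hcapm, if_neg (by omega)] at h1
    omega
  have hw : ∀ (b : Fin m) (u : Fin n), I.inputReal 0 b u = I.w b u := by
    intro b u
    simp [UAInstance.inputReal]
  have hwm : ∀ u, I.inputReal 0 m u = 0 := by
    intro u
    simp [UAInstance.inputReal]
  have hxa : ∀ (b : Fin m) (u : Fin n),
      s.association m n b u = fixedPart I b u + if a u = b then 1 else 0 := by
    intro b u
    rw [Store.association, hx b b.2 u u.2]
    split_ifs with hab
    · rw [fixedPart_of_asks I ((hact' u).1 (by omega))]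
    · rfl
  have hsum : ∀ b : Fin m, ∑ u, s.association m n b u =
      ∑ u ∈ Finset.range n, fixedPart I b u + load n a b := by
    intro b
    simp only [hxa, Finset.sum_add_distrib, load, Finset.sum_range]
  have hnum : ∀ b : Fin m, I.inputNat 1 b 0 = I.numSub b := by
    intro b
    simp [UAInstance.inputNat]
  have hload : ∀ b : Fin m, load n a b + r b =
      I.numSub b - ∑ u ∈ Finset.range n, fixedPart I b u := by
    intro b
    have h1 := hbal.eq b b.2.le
    rw [if_neg (by omega), hcap b b.2, hnum] at h1
    omega
  have hopt : s.flag = 1 → I.IsOptimal (s.association m n) := by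
    intro hf
    obtain ⟨hf1, hf2⟩ := hflag'.1 hf
    have hf1' : ∀ b : Fin m, ∑ u ∈ Finset.range n, fixedPart I b u ≤ I.numSub b := by
      intro b
      rw [← hnum b]
      exact hf1 b b.2
    have hnone : ∀ u : Fin n, I.asks u = false → ∀ b : Fin m, a u ≠ b := by
      intro u hu b hab
      have := (hact' u).1 (by omega)
      rw [hu] at this
      exact Bool.false_ne_true this
    have hfeas : I.IsFeasible (s.association m n) := by
      refine ⟨fun b => ?_, fun u => ?_, fun u hu b => ?_, fun u b => ?_⟩
      · have := hload b
        have := hf1' b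
        rw [hsum]
        omega
      · cases hu : I.asks u with
        | false =>
          simp only [hxa, hnone u hu, if_false, add_zero]
          rw [← Finset.sum_range (fun b => fixedPart I b u)]
          exact hf2 u u.2
        | true =>
          simp only [hxa, fixedPart_of_asks I hu, zero_add]
          rw [← Finset.sum_range (fun b => if a u = b then 1 else 0), Finset.sum_ite_eq]
          split_ifs <;> omega
      · rw [hxa, if_neg (hnone u hu b), fixedPart_of_not_asks I b hu, add_zero]
      · rw [hxa]
        cases hu : I.asks u with
        | false =>
          rw [if_neg (hnone u hu b), fixedPart_of_not_asks I b hu]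
          cases I.prev b u <;> simp
        | true =>
          rw [fixedPart_of_asks I hu]
          split_ifs <;> simp
    refine hfeas.isOptimal_of_dual (fun b => p b) (fun u => y u) ?_ ?_ ?_ ?_ ?_ ?_
    · intro u hu b
      rw [← hw]
      exact hdual.le u u.2 ((hact' u).2 hu) b b.2.le
    · intro u hu b hxb
      have hab : a u = b := by
        by_contra hab
        rw [hxa, fixedPart_of_asks I hu, if_neg hab] at hxb
        omega
      have := hdual.tight u u.2 (hle u hu)
      rwa [hab, hw] at this
    · exact fun b => hdual.nonneg b b.2.le
    · intro u hu
      have := hdual.le u u.2 ((hact' u).2 hu) m le_rfl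
      rwa [hwm, hpm, add_zero] at this
    · intro u hu
      rcases (hle u hu).lt_or_eq with h | h
      · right
        simp only [hxa, fixedPart_of_asks I hu, zero_add]
        rw [← Finset.sum_range (fun b => if a u = b then 1 else 0), Finset.sum_ite_eq,
          if_pos (Finset.mem_range.2 h)]
      · left
        have := hdual.tight u u.2 (hle u hu)
        rw [h, hwm, hpm, add_zero] at this
        exact this.symm
    · intro b
      rw [or_iff_not_imp_left]
      intro hpb
      have hrb : r b = 0 := by
        by_contra hrb
        exact hpb (hdual.compl b b.2.le hrb)
      have := hload b
      have := hf1' b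
      rw [hsum]
      omega
  -- Every feasible solution dominates the fixed part, so if there is one, all checks succeed.
  constructor
  · rintro ⟨z, hz⟩
    have hf : s.flag = 1 := by
      refine hflag'.2 ⟨fun b hb => ?_, fun u hu => ?_⟩
      · rw [Finset.sum_range, hnum ⟨b, hb⟩]
        exact (Finset.sum_le_sum fun u _ => fixedPart_le I hz ⟨b, hb⟩ u).trans (hz.capacity _)
      · rw [Finset.sum_range]
        exact (Finset.sum_le_sum fun b _ => fixedPart_le I hz b ⟨u, hu⟩).trans (hz.atMostOne _)
    exact ⟨hf, hopt hf⟩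
  · intro hno
    have : s.flag ≠ 1 := fun hf => hno ⟨_, (hopt hf).1⟩
    omega

end

/-- The program for the user-association problem.

The arrays `6`, …, `9` of natural numbers and the real arrays `1` and `2` are the ones named by
`Store.free`, `Store.placement`, `Store.rank`, `Store.parent`, `Store.price` and `Store.value`. The
other arrays beyond input and output hold one number each: `10`, `11` and `12` are loop counters,
the last of them for the user to be placed, `13` is the largest rank in the tree, `15` and `16` are
the current station and user, `17` is the next station of the path, `18` tells whether a free place
has been found, `19` is an accumulator, and the real array `3` holds the smallest slack. -/
def solver : Prog :=
  .seq (assign 4 (.const 1)) <| .seq copyFixed <| .seq initFree <| .seq initUsers <|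
  .seq (assignEntry 6 numStations (.add numUsers (.const 1))) <|
  .seq (forLoop 12 numUsers <|
    .cond (.natLt (.const 0) (entry 2 (scalar 12))) placeUser .nop)
  writeOutput

lemma run_solver {m n : ℕ} (I : UAInstance (Fin m) (Fin n)) :
    Run (m + n + 3) solver I.input fun s => s.Solves I := by
  have hm : I.input.nat 0 0 0 = m := rfl
  have hn : I.input.nat 0 0 1 = n := rfl
  refine .seq (.putNat (.seq ?_))
  simp only [NExpr.eval]
  generalize hs₀ : I.input.setNat 4 0 0 1 = s₀
  have h₀ : Same [4, 5, 6, 7, 10, 11, 19] [] I.input s₀ :=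
    hs₀ ▸ (Same.refl _ _ _).setNat _ _ _ _
  refine (run_copyFixed (s := s₀) (m := m) (n := n) (by omega) (by omega)
    (by rw [h₀.nat 0 (by decide), hm]) (by rw [h₀.nat 0 (by decide), hn]) ?_).mono ?_
  · intro b u
    rw [← hs₀]
    simp [UAInstance.input, UAInstance.inputNat]
  rintro s₁ ⟨h₁, hx₁⟩
  have k₁ : Same [4, 5, 6, 7, 10, 11, 19] [] I.input s₁ := h₀.trans h₁
  replace hx₁ : ∀ b < m, ∀ u < n, s₁.nat 5 b u = fixedPart I b u := by
    intro b hb u hu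
    rw [hx₁ b hb u hu, h₀.nat 2 (by decide), h₀.nat 3 (by decide)]
    rfl
  refine .seq ((run_initFree (m := m) (n := n) (by omega) (by omega)
    (by rw [k₁.nat 0 (by decide), hm]) (by rw [k₁.nat 0 (by decide), hn]) ?_).mono ?_)
  · rw [h₁.nat 4 (by decide), ← hs₀]
    simp
  rintro s₂ ⟨h₂, hr₂, hf₂, hf₂'⟩
  have k₂ : Same [4, 5, 6, 7, 10, 11, 19] [] I.input s₂ := k₁.trans h₂
  refine .seq ((run_initUsers (m := m) (n := n) (by omega) (by omega)
    (by rw [k₂.nat 0 (by decide), hm]) (by rw [k₂.nat 0 (by decide), hn]) hf₂).mono ?_)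
  rintro s₃ ⟨h₃, ha₃, hf₃, hf₃'⟩
  have k₃ : Same [4, 5, 6, 7, 10, 11, 19] [] I.input s₃ := k₂.trans h₃
  have hrow : ∀ b < m, ∑ u ∈ Finset.range n, s₁.nat 5 b u =
      ∑ u ∈ Finset.range n, fixedPart I b u := fun b hb =>
    Finset.sum_congr rfl fun u hu => hx₁ b hb u (Finset.mem_range.1 hu)
  have hcol : ∀ u < n, ∑ b ∈ Finset.range m, s₂.nat 5 b u =
      ∑ b ∈ Finset.range m, fixedPart I b u := fun u hu =>
    Finset.sum_congr rfl fun b hb => by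
      rw [h₂.nat 5 (by decide), hx₁ b (Finset.mem_range.1 hb) u hu]
  have hflag' : s₃.flag = 1 ↔
      (∀ b < m, ∑ u ∈ Finset.range n, fixedPart I b u ≤ I.inputNat 1 b 0) ∧
      ∀ u < n, ∑ b ∈ Finset.range m, fixedPart I b u ≤ 1 := by
    rw [hf₃', hf₂']
    refine and_congr (forall₂_congr fun b hb => ?_) (forall₂_congr fun u hu => ?_)
    · rw [hrow b hb, k₁.nat 1 (by decide)]
      rfl
    · rw [hcol u hu]
  refine .seq (.putNat (.seq ?_))
  simp only [NExpr.eval, k₃.nat 0 (by decide), hm, hn]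
  -- With `n + 1` places, the station `m` can never become full.
  generalize hs₄ : s₃.setNat 6 m 0 (n + 1) = s₄
  have k₄ : Same [4, 5, 6, 7, 10, 11, 19] [] I.input s₄ := hs₄ ▸ k₃.setNat _ _ _ _
  have ha₄ : ∀ u < n, s₄.placement u = m + 2 := by
    intro u hu
    rw [Store.placement_congr (s := s₃) (by simp [← hs₄]), ha₃ u hu]
  have hcapm : s₄.free m = n + 1 := by simp [← hs₄]
  have hcap : ∀ b < m, s₄.free b =
      I.inputNat 1 b 0 - ∑ u ∈ Finset.range n, fixedPart I b u := by
    intro b hb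
    have hbm : b ≠ m := hb.ne
    have h := hr₂ b hb
    rw [hrow b hb, k₁.nat 1 (by decide), ← Store.free_congr (h₃.nat 6 (by decide))] at h
    rw [← hs₄, ← show I.input.nat = I.inputNat from rfl]
    simpa [hbm] using h
  have hload : ∀ c ≤ m + 1, load n s₄.placement c = 0 := by
    intro c hc
    rw [load_eq_zero]
    intro u hu
    rw [ha₄ u hu]
    omega
  have hinit : Placed m n s₄.free (fun v => I.inputNat 2 v 0 ≠ 0 ∧ v < 0) s₄ := by
    have h1 : ∀ c, s₄.price c = 0 := by
      intro c
      rw [Store.price_apply, k₄.real 1 (by decide)]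
      simp [UAInstance.input, UAInstance.inputReal]
    refine ⟨?_, ?_, ?_, ⟨?_, ?_, ?_, ?_⟩, ⟨?_, ?_, ?_⟩, ?_, ?_⟩
    · rw [k₄.nat 0 (by decide), hm]
    · rw [k₄.nat 0 (by decide), hn]
    · intro v
      rw [k₄.real 0 (by decide)]
      simp [UAInstance.input, UAInstance.inputReal]
    · intro v hv hav
      rw [ha₄ v hv] at hav
      omega
    · intro v hv hav
      rw [ha₄ v hv] at hav
      omega
    · exact fun c _ => (h1 c).ge
    · exact fun c _ _ => h1 c
    · exact fun v hv => (ha₄ v hv).le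
    · intro c hc
      rw [hload c (by omega), if_neg (by omega)]
      omega
    · rw [hload _ le_rfl, if_pos rfl]
    · rw [Store.rank_apply, k₄.nat 8 (by decide)]
      simp [UAInstance.input, UAInstance.inputNat]
    · intro v hv
      simp [ha₄ v hv, -Store.placement_apply]
  refine .forLoop (fun i s => Same [6, 7, 8, 9, 10, 11, 12, 13, 15, 16, 17, 18] [1, 2, 3] s₄ s ∧
    Placed m n s₄.free (fun v => I.inputNat 2 v 0 ≠ 0 ∧ v < i) s) (Nv := n) (by omega) ?_ ?_ ?_ ?_
  · rintro i s ⟨-, h⟩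
    simpa [NExpr.eval] using h.users
  · refine ⟨(Same.refl _ _ _).setNat _ _ _ _, ?_⟩
    exact hinit.setNat _ _ _
  · rintro i s hi hc ⟨h, hpl⟩
    have h2 : s.nat 2 = I.inputNat 2 := by
      rw [h.nat 2 (by decide), k₄.nat 2 (by decide)]
      rfl
    refine .cond (fun ht => ?_) (fun ht => .nop ?_)
    · simp only [Test.Holds, NExpr.eval, hc, h2] at ht
      refine (run_placeUser (by omega) (by omega) hcapm hpl hc hi (by simp)).mono ?_
      rintro s' ⟨h', hpl'⟩
      refine ⟨by rw [h'.nat 12 (by decide), hc], (h.trans h').setNat _ _ _ _, ?_⟩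
      refine (hpl'.congr fun v => ?_).setNat _ _ _
      by_cases hvi : v = i
      · simp [hvi, ht.ne']
      · have : v < i + 1 ↔ v < i := by omega
        simp [hvi, this]
    · simp only [Test.Holds, NExpr.eval, hc, h2, Nat.pos_iff_ne_zero, not_not] at ht
      refine ⟨hc, h.setNat _ _ _ _, (hpl.congr fun v => ?_).setNat _ _ _⟩
      by_cases hvi : v = i
      · simp [hvi, ht]
      · have : v < i + 1 ↔ v < i := by omega
        simp [this]
  rintro s₅ ⟨h₅, hpl⟩
  refine (run_writeOutput (by omega) hpl.stations hpl.users).mono ?_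
  rintro s₆ ⟨h₆, hx₆⟩
  have hflag₆ : s₆.flag = s₃.flag := by
    simp [Store.flag, h₆.nat, h₅.nat, ← hs₄]
  have hdual := hpl.dual
  rw [h₅.real 0 (by decide), k₄.real 0 (by decide)] at hdual
  refine solves_of_dual I (fun b hb u hu => ?_) (hflag₆ ▸ hf₃) (hflag₆ ▸ hflag') hpl.balanced hcapm
    hcap hdual fun u hu => ?_
  · rw [hx₆ b hb u hu]
    congr 1
    rw [← hx₁ b hb u hu]
    simp [h₅.nat, ← hs₄, h₃.nat, h₂.nat]
  · rw [hpl.active u hu]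
    simp [hu]

end RealRAM

theorem mainTheorem2 :
    ∃ (P : RealRAM.Prog) (p : Polynomial ℕ),
      ∀ (m n : ℕ) (I : UAInstance (Fin m) (Fin n)),
        ∃ (T : ℕ) (s : RealRAM.Store),
          RealRAM.Exec P I.input T s ∧ T ≤ p.eval (m + n) ∧ s.Solves I := by
  refine ⟨RealRAM.solver, RealRAM.solver.costPoly.comp (Polynomial.X + 3), fun m n I => ?_⟩
  obtain ⟨T, s, h1, h2, h3⟩ := RealRAM.run_solver I
  exact ⟨T, s, h1, by simpa [Polynomial.eval_comp] using h2, h3⟩
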